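/- **Setting.** Let $n_d,n_c,n_r,n_s\ge 0$ be integers and $q=\max\{n_d,n_c,n_r,n_s\}$. In the symmetric linear-deterministic interference relay channel (LD-IRC), transmitter $i\in\{1,2\}$ sends $x_i[k]\in\mathbb F_2^q$ and the relay sends $x_r[k]\in\mathbb F_2^q$ in channel use $k=1,\dots,n$. With the $q\times q$ down-shift matrix $S$, the relay receives $y_r[k]=S^{q-n_s}x_1[k]\oplus S^{q-n_s}x_2[k]$ and receiver $j$ (with $l\ne j$ the other user) receives $y_j[k]=S^{q-n_d}x_j[k]\oplus S^{q-n_c}x_l[k]\oplus S^{q-n_r}x_r[k]$; $x_r[k]$ is a function of $y_r[1],\dots,y_r[k-1]$ and $x_r[1]=0$. A rate pair $(R_1,R_2)$, $R_i\ge0$, is achievable if there are codes of lengths $n=1,2,\dots$ with independent uniform messages from $\{1,\dots,\lfloor 2^{nR_i}\rfloor\}$ whose average error probability (the probability that some receiver errs) tends to $0$. The sum-capacity $C_\Sigma$ is the supremum of $R_1+R_2$ over the achievable pairs. Write $x^+=\max\{x,0\}$. **Scheme WI-1.** Choose an integer $T\ge1$ and group $T$ channel uses into one block, which acts as one use of an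 LD-IRC with strengths $Tn_d,Tn_c,Tn_r,Tn_s$. For integers $\ell_1,\ell_2,r_{cn},r_{df1},r_{df2},r_{cf},r_p\ge0$ and $K$ blocks, user $i$ has in each block $k=1,\dots,K-1$ fresh information vectors $u_{i,cn}[k],\tilde u_{i,df1}[k],\tilde u_{i,df2}[k],u_{i,cf}[k],u_{i,p}[k]$ of these lengths (all vectors with index $0$ or $K$ are zero). Put $u_{1,dfm}=(\tilde u_{1,dfm};0)$ and $u_{2,dfm}=(0;\tilde u_{2,dfm})$, of length $2r_{dfm}$, for $m=1,2$. In block $k$ transmitter $i$ sends the column which consists, from top to bottom, of $\ell_1$ zeros, $u_{i,cn}[k-1]$ with $u_{i,df1}[k]$ added to its first $2r_{df1}$ entries, $u_{i,cf}[k]$, $u_{i,p}[k]$, $u_{i,cn}[k]$, $u_{i,df2}[k]$, and zeros. The relay sends the column which consists of $u_{r,cf}[k],u_{r,df1}[k],u_{r,df2}[k]$, $\ell_2$ zeros, $u_{r,cn}[k]$, and zeros, where $u_{r,\cdot}[k]=u_{1,\cdot}[k-1]\oplus u_{2,\cdot}[k-1]$. It is required that $2r_{df1}\le r_{cn}$,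 that the columns fit into $Tq$ entries, and, if $r_{cn}>0$, that $u_{r,cn}[k]$ is aligned with the cn vector $u_{l,cn}[k-1]$ of the undesired transmitter at each receiver, i.e. $r_{cf}+2r_{df1}+2r_{df2}+\ell_2+Tn_c=Tn_r+\ell_1$. WI-1 achieves the sum-rate $2(r_{cn}+r_{df1}+r_{df2}+r_{cf}+r_p)/T=\lim_{K\to\infty}\frac{2(K-1)(r_{cn}+r_{df1}+r_{df2}+r_{cf}+r_p)}{KT}$ if, for every $K$, the relay can causally generate its columns and both receivers can decode their messages without error. **Proposition.** Let $n_c<n_d$ (weak interference), let one of the four cases hold, and let $$R=\begin{cases}\min\{n_s+n_d,\;n_r+n_s-n_c\}& n_c<n_d\le n_s\le n_r,\\ \min\{2n_d,\;n_r+n_d-n_c\}& n_c\le n_s\le n_d\le n_r,\\ \min\{n_r+n_d,\;n_r+n_s-n_c\}& n_c<n_d\le n_r\le n_s,\\ \min\{2n_d,\;n_s+n_d-n_c\}& n_c\le n_r\le n_d\le n_s.\end{cases}$$ Then: 1. $R$ is the largest sum-rate that scheme WI-1 achieves. 2. $R$ is the sum-capacity: $C_\Sigma=R$. 3. $R$ is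 the smallest among the upper bounds $\max\{n_d,n_c,n_r\}+\max\{n_d,n_c\}$; $\;n_r+2\max\{n_d,n_c\}-n_c$; $\;\max\{n_d,n_c\}+\max\{n_d,n_s\}$; $\;2\max\{n_c,n_r,n_d-\max\{n_c,n_s\}\}+2(n_s-n_c)^+$; $\;2\max\{n_d,n_r\}$; $\;\max\{n_d,n_r,n_c\}+\max\{n_d,n_c\}-n_c+(n_s-\max\{n_d,n_c\})^+$; $\;2\max\{n_c,n_r+n_d-n_c\}$ (the last one only if $n_r\le n_c\le n_d$); and $\max\{n_d,\min\{n_r,n_s\}\}$ (only if $n_d=n_c$). 4. If moreover $n_c<n_s$, then $R$ equals $$\min\left\{\begin{array}{l}2\max\{n_d,n_r\},\\ \max\{n_d,n_c,n_r\}+\max\{n_d,n_c\}-\bigl(n_c-(n_s-\max\{n_d,n_c\})^+\bigr)^+,\\ n_r+2\max\{n_d,n_c\}-n_c,\\ 2\max\{n_s,\,n_r+n_s-n_c,\,n_d-n_c\},\\ \max\{n_d,n_c\}+\max\{n_d,n_s\},\\ 2\max\{n_c,\,n_r+(n_d-n_c)^+\}\end{array}\right\}.$$ -/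

import Mathlib

open Filter Topology

noncomputable section

/-- A symmetric two-user linear-deterministic interference relay channel (LD-IRC), given by its
bit-level strengths: `nd` (direct links), `nc` (cross links), `nr` (relay-receiver links) and
`ns` (transmitter-relay links). -/
structure LDIRC where
  nd : ℕ
  nc : ℕ
  nr : ℕ
  ns : ℕ

namespace LDIRC

/-- Length of the input vectors. -/
def q (H : LDIRC) : ℕ := max (max H.nd H.nc) (max H.nr H.ns)

/-- Channel symbols: binary column vectors of length `q`; the entry `0` is the top-most bit. -/
abbrev Vec (H : LDIRC) : Type := Fin H.q → ZMod 2

/-- The `q × q` down-shift matrix over `𝔽₂`, with ones exactly on the first subdiagonal. -/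
def shiftMatrix (q : ℕ) : Matrix (Fin q) (Fin q) (ZMod 2) :=
  Matrix.of fun a b => if (a : ℕ) = b + 1 then 1 else 0

/-- A link of strength `m`: the vector is shifted down by `q - m`, so that only its top-most `m`
bits survive. -/
def link (H : LDIRC) (m : ℕ) (x : H.Vec) : H.Vec :=
  Matrix.mulVec (shiftMatrix H.q ^ (H.q - m)) x

/-- A code with `n` channel uses for the message sets `W 0`, `W 1` of the two users. The channel
uses are indexed by `0, …, n - 1`. The relay is causal: its map for channel use `t` only sees its
received vectors of the channel uses before `t`. -/
structure Code (H : LDIRC) (n : ℕ) (W : Fin 2 → Type) where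
  enc : (i : Fin 2) → W i → Fin n → H.Vec
  relay : (t : Fin n) → (Fin (t : ℕ) → H.Vec) → H.Vec
  dec : (i : Fin 2) → (Fin n → H.Vec) → W i

namespace Code

variable {H : LDIRC} {n : ℕ} {W : Fin 2 → Type}

/-- The vector received by the relay in channel use `t`. -/
def relayIn (C : H.Code n W) (w : ∀ i, W i) (t : Fin n) : H.Vec :=
  H.link H.ns (C.enc 0 (w 0) t) + H.link H.ns (C.enc 1 (w 1) t)

/-- The vector sent by the relay in channel use `t`; the relay is silent in the first one. -/
def relayOut (C : H.Code n W) (w : ∀ i, W i) (t : Fin n) : H.Vec :=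
  if (t : ℕ) = 0 then 0 else C.relay t fun s => C.relayIn w ⟨s, s.2.trans t.2⟩

/-- The vector received by receiver `i` in channel use `t`; `1 - i` is the other user. -/
def rxIn (C : H.Code n W) (w : ∀ i, W i) (i : Fin 2) (t : Fin n) : H.Vec :=
  H.link H.nd (C.enc i (w i) t) + H.link H.nc (C.enc (1 - i) (w (1 - i)) t)
    + H.link H.nr (C.relayOut w t)

/-- The message that receiver `i` decides for. -/
def decoded (C : H.Code n W) (w : ∀ i, W i) (i : Fin 2) : W i :=
  C.dec i (C.rxIn w i)

/-- Average error probability for independent, uniformly distributed messages (finite message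
sets): the fraction of the message pairs for which some receiver errs. -/
def errorProb (C : H.Code n W) : ℝ :=
  (Nat.card {w : ∀ i, W i // ∃ i, C.decoded w i ≠ w i} : ℝ) / Nat.card (∀ i, W i)

/-- Sum-rate of a code, in bits per channel use. -/
def sumRate (_C : H.Code n W) : ℝ :=
  (∑ i, Real.logb 2 (Nat.card (W i))) / n

end Code

/-- A rate pair `(R 0, R 1)` is achievable if there are `(n, 2^(n R 0), 2^(n R 1))` codes whose
error probability tends to `0`. -/
def Achievable (H : LDIRC) (R : Fin 2 → ℝ) : Prop :=
  (∀ i, 0 ≤ R i) ∧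
    ∃ C : (n : ℕ) → H.Code n (fun i => Fin ⌊(2 : ℝ) ^ ((n : ℝ) * R i)⌋₊),
      Tendsto (fun n => (C n).errorProb) atTop (𝓝 0)

/-- The sum-rates of all achievable rate pairs; the sum-capacity is the least upper bound. -/
def achievableSumRates (H : LDIRC) : Set ℝ :=
  {s | ∃ R : Fin 2 → ℝ, H.Achievable R ∧ s = R 0 + R 1}

end LDIRC

/-- The five kinds of signals in the scheme: cooperative interference neutralization (`cn`), two
decode-forward signals (`df1`, `df2`), compute-forward (`cf`), private (`p`). -/
inductive Layer
  | cn | df1 | df2 | cf | p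

/-- Parameters of scheme WI-1. The scheme is run on blocks of `T` channel uses, which act as one
use of a channel with all the strengths multiplied by `T` (so that bit numbers per channel use may
be fractions). `R s` is the number of information bits of kind `s` that a transmitter sends per
block, `l1` and `l2` are the lengths of the zero paddings in the transmit and the relay vectors. -/
structure WI1 where
  T : ℕ
  l1 : ℕ
  l2 : ℕ
  R : Layer → ℕ

namespace WI1

open Layer

/-- The information bits of one user in one block. -/
abbrev Info (P : WI1) : Type := (s : Layer) → Fin (P.R s) → ZMod 2

/-- The message of one user: fresh information bits for all of the `K` blocks but the last. -/
abbrev Msg (P : WI1) (K : ℕ) : Type := Fin (K - 1) → P.Info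

/-- The information vector of kind `s` of block `k`, where `k = 1, …, K - 1`; it is zero for
`k = 0` and `k = K`. -/
def u (P : WI1) {K : ℕ} (w : P.Msg K) (s : Layer) (k : ℕ) : Fin (P.R s) → ZMod 2 :=
  if h : 1 ≤ k ∧ k - 1 < K - 1 then w ⟨k - 1, h.2⟩ s else 0

/-- The column that carries the vector `v` below `off` leading zeros, and is zero elsewhere. -/
def place (off : ℕ) {len : ℕ} (v : Fin len → ZMod 2) (a : ℕ) : ZMod 2 :=
  if h : off ≤ a ∧ a - off < len then v ⟨a - off, h.2⟩ else 0

/-- The column sent by transmitter `i` in block `k = 1, …, K`. From top to bottom: `l1` zeros; the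
previous `cn` vector, with the first decode-forward vector added to its top-most `2 R df1` bits;
the `cf` vector; the private vector; the current `cn` vector; the second decode-forward vector.
A decode-forward vector has twice as many entries as information bits: user `0` uses the upper
half and user `1` the lower half, the other half being zero. -/
def tx (P : WI1) {K : ℕ} (i : Fin 2) (w : P.Msg K) (k : ℕ) (a : ℕ) : ZMod 2 :=
  place P.l1 (P.u w cn (k - 1)) a
    + place (P.l1 + i * P.R df1) (P.u w df1 k) a
    + place (P.l1 + P.R cn) (P.u w cf k) a
    + place (P.l1 + P.R cn + P.R cf) (P.u w p k) a
    + place (P.l1 + P.R cn + P.R cf + P.R p) (P.u w cn k) a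
    + place (P.l1 + P.R cn + P.R cf + P.R p + P.R cn + i * P.R df2) (P.u w df2 k) a

/-- The number of entries above the `cn` vector in the column sent by the relay. -/
def relayCnOffset (P : WI1) : ℕ := P.R cf + 2 * P.R df1 + 2 * P.R df2 + P.l2

/-- The column sent by the relay in block `k = 1, …, K`. From top to bottom: the sums over both
users of the previous `cf` vectors and of the previous first and second decode-forward vectors;
`l2` zeros; the sum of the previous `cn` vectors. -/
def relayTx (P : WI1) {K : ℕ} (w : Fin 2 → P.Msg K) (k : ℕ) (a : ℕ) : ZMod 2 :=
  ∑ i : Fin 2,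
    (place 0 (P.u (w i) cf (k - 1)) a
      + place (P.R cf + i * P.R df1) (P.u (w i) df1 (k - 1)) a
      + place (P.R cf + 2 * P.R df1 + i * P.R df2) (P.u (w i) df2 (k - 1)) a
      + place P.relayCnOffset (P.u (w i) cn (k - 1)) a)

/-- The columns above can be formed, and the `cn` vector of the relay arrives at each receiver at
the bit levels of the previous `cn` vector of the undesired transmitter, so as to neutralize it. -/
structure Admissible (P : WI1) (H : LDIRC) : Prop where
  T_pos : 0 < P.T
  df1_le : 2 * P.R df1 ≤ P.R cn
  tx_length : P.l1 + 2 * P.R cn + P.R cf + P.R p + 2 * P.R df2 ≤ P.T * H.q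
  relay_length : P.relayCnOffset + P.R cn ≤ P.T * H.q
  aligned : 0 < P.R cn → P.relayCnOffset + P.T * H.nc = P.T * H.nr + P.l1

/-- A code over `K` blocks that transmits according to scheme WI-1. Channel use `t` is use number
`t % T` of block `t / T + 1`, and bit level `l` in that channel use carries the entry
`l * T + t % T` of the column of the block. -/
def IsCode (P : WI1) (H : LDIRC) (K : ℕ) (C : H.Code (K * P.T) (fun _ => P.Msg K)) : Prop :=
  (∀ (i : Fin 2) (w : P.Msg K) (t : Fin (K * P.T)) (l : Fin H.q),
    C.enc i w t l = P.tx i w ((t : ℕ) / P.T + 1) ((l : ℕ) * P.T + (t : ℕ) % P.T)) ∧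
  (∀ (w : Fin 2 → P.Msg K) (t : Fin (K * P.T)) (l : Fin H.q),
    C.relayOut w t l = P.relayTx w ((t : ℕ) / P.T + 1) ((l : ℕ) * P.T + (t : ℕ) % P.T))

/-- Scheme WI-1 achieves the sum-rate `r`: for some choice of the parameters, there is for every
number `K` of blocks a WI-1 code that both receivers decode without error, and the sum-rate of
these codes tends to `r`. -/
def Achieves (H : LDIRC) (r : ℝ) : Prop :=
  ∃ P : WI1, P.Admissible H ∧
    ∃ C : (K : ℕ) → H.Code (K * P.T) (fun _ => P.Msg K),
      (∀ K, P.IsCode H K (C K) ∧ ∀ w i, (C K).decoded w i = w i) ∧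
      Tendsto (fun K => (C K).sumRate) atTop (𝓝 r)

end WI1

namespace LDIRC

/-- The cut-set and genie-aided upper bounds on the sum-capacity (two of them are only claimed
under a condition on the channel). -/
def upperBounds (H : LDIRC) : Set ℝ :=
  {b | ∃ nd nc nr ns : ℝ, nd = H.nd ∧ nc = H.nc ∧ nr = H.nr ∧ ns = H.ns ∧
    ((nd = nc ∧ b = max nd (min nr ns)) ∨
      b = max (max nd nc) nr + max nd nc ∨
      b = nr + 2 * max nd nc - nc ∨
      b = max nd nc + max nd ns ∨
      b = 2 * max (max nc nr) (nd - max nc ns) + 2 * max (ns - nc) 0 ∨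
      (nr ≤ nc ∧ nc ≤ nd ∧ b = 2 * max nc (nr + nd - nc)) ∨
      b = 2 * max nd nr ∨
      b = max (max nd nr) nc + max nd nc - nc + max (ns - max nd nc) 0)}

/-- The sum-capacity expression for `nc < ns` and `nc ≠ nd`. -/
def capacityFormula (nd nc nr ns : ℝ) : ℝ :=
  min (2 * max nd nr)
    (min (max (max nd nc) nr + max nd nc - max (nc - max (ns - max nd nc) 0) 0)
      (min (nr + 2 * max nd nc - nc)
        (min (2 * max (max ns (nr + ns - nc)) (nd - nc))
          (min (max nd nc + max nd ns)
            (2 * max nc (nr + max (nd - nc) 0))))))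

end LDIRC

end

/-! Converse. Correctly decoded message pairs are separated by suitable observations, so their
number is at most 2 to the number of observed bits. Three observations suffice. (a) `y₀` and `y₀ +
y₁`: the relay signal is common to both receivers and cancels in the sum, so the sum occupies only
`nd` levels. (b) The relay's input, receiver `0`'s input without its relay part, and the levels of
`x₁` hidden from the relay. (c) `y₀` and the levels of `x₁` below the top `nc`: after decoding its
own message, receiver `0` recovers the top `nc` levels of `x₁` one channel use at a time, since
causality gives it the relay signal from the past. The minimum of the three counts is `tightBound`,
which equals the claimed value in all four cases. A counting bound limits the capacity as soon as
half of the message pairs are decoded correctly, and it limits zero-error codes, hence WI-1,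
directly.

Achievability. WI-1 is linear over 𝔽₂, so decoding amounts to showing that zero observations force
zero messages. The relay works forward over the blocks (`RelaySilent.succ`), the receivers backward
(`ReceiverSilent.pred`). At a receiver the relay's `cf` and decode-forward parts arrive above both
transmit signals. Further down, the relay's `cn` sum turns the interfering `cn` vector into the
desired one, and the known `cf` sum does the same for `cf`. The interference becomes a delayed copy
of the desired signal, and `nc < nd` lets it be peeled off from the top. Explicit parameters with `T
= 2` attain `tightBound` (`exists_decodable`); padding and embedding of messages turn the scheme
into codes of every large length (`achievable_of_decodable`). -/

noncomputable section

/-! ### Links as shifts, and segments of vectors -/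

namespace LDIRC

variable {H : LDIRC}

theorem shiftMatrix_mulVec (q : ℕ) (x : Fin q → ZMod 2) (l : Fin q) :
    (shiftMatrix q).mulVec x l = if h : 1 ≤ (l : ℕ) then x ⟨l - 1, by omega⟩ else 0 := by
  simp only [Matrix.mulVec, dotProduct, shiftMatrix, Matrix.of_apply, ite_mul, one_mul, zero_mul]
  split_ifs with h
  · rw [Finset.sum_eq_single ⟨(l : ℕ) - 1, by omega⟩]
    · rw [if_pos]; simp only; omega
    · intro b _ hb
      rw [if_neg]
      intro hl
      exact hb (Fin.ext (by simp only; omega))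
    · simp
  · refine Finset.sum_eq_zero fun b _ => if_neg (by omega)

theorem shiftMatrix_pow_mulVec (q s : ℕ) (x : Fin q → ZMod 2) (l : Fin q) :
    (shiftMatrix q ^ s).mulVec x l = if h : s ≤ (l : ℕ) then x ⟨l - s, by omega⟩ else 0 := by
  induction s generalizing l with
  | zero => simp
  | succ s ih =>
    rw [pow_succ', ← Matrix.mulVec_mulVec, shiftMatrix_mulVec]
    by_cases h : 1 ≤ (l : ℕ)
    · rw [dif_pos h, ih]
      by_cases h2 : s + 1 ≤ (l : ℕ)
      · rw [dif_pos h2, dif_pos (by simp only; omega)]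
        congr 2
        simp only
        omega
      · rw [dif_neg h2, dif_neg (by simp only; omega)]
    · rw [dif_neg h, dif_neg (by omega)]

theorem link_apply (H : LDIRC) (m : ℕ) (x : H.Vec) (l : Fin H.q) :
    H.link m x l = if h : H.q - m ≤ (l : ℕ) then x ⟨l - (H.q - m), by omega⟩ else 0 :=
  shiftMatrix_pow_mulVec _ _ _ _

theorem link_add (H : LDIRC) (m : ℕ) (x y : H.Vec) :
    H.link m (x + y) = H.link m x + H.link m y := Matrix.mulVec_add _ _ _

theorem link_eq_of_top (m : ℕ) {x x' : H.Vec} (h : ∀ a : Fin H.q, (a : ℕ) < m → x a = x' a) :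
    H.link m x = H.link m x' := by
  funext l
  simp only [link_apply]
  split_ifs with h1
  · exact h _ (by simp only; omega)
  · rfl

theorem top_of_link_eq {m : ℕ} (hm : m ≤ H.q) {x x' : H.Vec} (h : H.link m x = H.link m x')
    (a : Fin H.q) (ha : (a : ℕ) < m) : x a = x' a := by
  have h1 := congrFun h ⟨a + (H.q - m), by omega⟩
  simpa [link_apply] using h1

theorem nd_le_q (H : LDIRC) : H.nd ≤ H.q := by simp [q]
theorem nc_le_q (H : LDIRC) : H.nc ≤ H.q := by simp [q]
theorem nr_le_q (H : LDIRC) : H.nr ≤ H.q := by simp [q]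
theorem ns_le_q (H : LDIRC) : H.ns ≤ H.q := by simp [q]

/-- The entries `a, …, a + m - 1` of a vector, with zeros for the entries that do not exist. -/
def segment (a m : ℕ) (x : H.Vec) (j : Fin m) : ZMod 2 :=
  if h : a + j < H.q then x ⟨a + j, h⟩ else 0

theorem eq_of_segment_eq {a m : ℕ} {x x' : H.Vec} (h : segment a m x = segment a m x')
    (b : Fin H.q) (h1 : a ≤ b) (h2 : (b : ℕ) < a + m) : x b = x' b := by
  have h3 := congrFun h ⟨b - a, by omega⟩
  have h4 : a + ((b : ℕ) - a) = b := by omega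
  simpa [segment, h4] using h3

/-- Vectors that vanish above the lowest `m` levels are determined by these levels. -/
theorem eq_of_bottom_segment_eq {m : ℕ} {x x' : H.Vec}
    (h : segment (H.q - m) m x = segment (H.q - m) m x')
    (hx : ∀ l : Fin H.q, (l : ℕ) + m < H.q → x l = 0)
    (hx' : ∀ l : Fin H.q, (l : ℕ) + m < H.q → x' l = 0) : x = x' := by
  funext l
  by_cases hl : (l : ℕ) + m < H.q
  · rw [hx l hl, hx' l hl]
  · exact eq_of_segment_eq h l (by omega) (by omega)

theorem link_apply_eq_zero {k m : ℕ} (hkm : k ≤ m) (x : H.Vec) (l : Fin H.q)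
    (hl : (l : ℕ) + m < H.q) : H.link k x l = 0 := by
  rw [link_apply, dif_neg (by omega)]

theorem vec_add_self (x : H.Vec) : x + x = 0 := by
  funext l
  exact CharTwo.add_self_eq_zero _

/-! ### Counting bounds on the correctly decoded message pairs -/

namespace Code

variable {n : ℕ} {W : Fin 2 → Type}

/-- The message pairs that both receivers decode correctly. -/
def good (C : H.Code n W) : Set (∀ i, W i) := {w | ∀ i, C.decoded w i = w i}

theorem good_ext {C : H.Code n W} {w w' : ∀ i, W i} (hw : w ∈ C.good) (hw' : w' ∈ C.good)
    (i : Fin 2) (h : ∀ t, C.rxIn w i t = C.rxIn w' i t) : w i = w' i := by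
  rw [← hw i, ← hw' i, decoded, decoded, funext h]

/-- Causality of the relay, in the form used by the genie arguments. -/
theorem relayOut_congr (C : H.Code n W) {w w' : ∀ i, W i} (t : Fin n)
    (h : ∀ s : Fin n, s < t → C.relayIn w s = C.relayIn w' s) :
    C.relayOut w t = C.relayOut w' t := by
  simp only [relayOut]
  split_ifs
  · rfl
  · congr 1
    funext s
    exact h _ s.2

/-- The two components are the observations handed to a genie-aided decoder; their bit counts per
channel use add up. -/
theorem card_le_of_injOn {A : Set (∀ i, W i)} {m1 m2 : ℕ}
    (f : (∀ i, W i) → (Fin n → Fin m1 → ZMod 2) × (Fin n → Fin m2 → ZMod 2))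
    (hf : Set.InjOn f A) : Nat.card A ≤ 2 ^ (n * (m1 + m2)) := by
  have h := Nat.card_le_card_of_injective (fun a : A => f a) fun a b hab =>
    Subtype.ext (hf a.2 b.2 hab)
  refine h.trans (le_of_eq ?_)
  simp [Nat.card_eq_fintype_card, Fintype.card_prod]
  ring

theorem rxIn_zero (C : H.Code n W) (w : ∀ i, W i) (t : Fin n) : C.rxIn w 0 t =
    H.link H.nd (C.enc 0 (w 0) t) + H.link H.nc (C.enc 1 (w 1) t)
      + H.link H.nr (C.relayOut w t) := rfl

theorem rxIn_one (C : H.Code n W) (w : ∀ i, W i) (t : Fin n) : C.rxIn w 1 t =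
    H.link H.nd (C.enc 1 (w 1) t) + H.link H.nc (C.enc 0 (w 0) t)
      + H.link H.nr (C.relayOut w t) := rfl

theorem rxIn_apply_eq_zero (C : H.Code n W) (w : ∀ i, W i) (i : Fin 2) (t : Fin n)
    (hw : H.nc ≤ H.nd) (l : Fin H.q) (hl : (l : ℕ) + max H.nd H.nr < H.q) :
    C.rxIn w i t l = 0 := by
  simp only [rxIn, Pi.add_apply]
  rw [link_apply_eq_zero (le_max_left _ _) _ l hl,
    link_apply_eq_zero (hw.trans (le_max_left _ _)) _ l hl,
    link_apply_eq_zero (le_max_right _ _) _ l hl]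
  simp

/-- Both receivers see the same relay contribution, which cancels in characteristic two. -/
theorem rxIn_add_rxIn (C : H.Code n W) (w : ∀ i, W i) (t : Fin n) :
    C.rxIn w 0 t + C.rxIn w 1 t =
      H.link H.nd (C.enc 0 (w 0) t + C.enc 1 (w 1) t)
        + H.link H.nc (C.enc 0 (w 0) t + C.enc 1 (w 1) t) := by
  rw [rxIn_zero, rxIn_one, link_add, link_add]
  have h := vec_add_self (H.link H.nr (C.relayOut w t))
  linear_combination (exp := 1) h

theorem ext_pair {w w' : ∀ i, W i} (h0 : w 0 = w' 0) (h1 : w 1 = w' 1) : w = w' := by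
  funext i
  fin_cases i
  · exact h0
  · exact h1

/-- Cut around both receivers. -/
theorem card_good_le_receivers (C : H.Code n W) (hw : H.nc ≤ H.nd) :
    Nat.card C.good ≤ 2 ^ (n * (max H.nd H.nr + H.nd)) := by
  refine card_le_of_injOn (fun w =>
    (fun t => segment (H.q - max H.nd H.nr) _ (C.rxIn w 0 t),
     fun t => segment (H.q - H.nd) _ (C.rxIn w 0 t + C.rxIn w 1 t))) ?_
  intro w hg w' hg' h
  simp only [Prod.mk.injEq, funext_iff (f := fun t : Fin n => segment _ _ _)] at h
  obtain ⟨h1, h2⟩ := h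
  have e1 : ∀ t, C.rxIn w 0 t = C.rxIn w' 0 t := fun t =>
    eq_of_bottom_segment_eq (h1 t) (C.rxIn_apply_eq_zero w 0 t hw)
      (C.rxIn_apply_eq_zero w' 0 t hw)
  have hz : ∀ (w : ∀ i, W i) (t : Fin n) (l : Fin H.q), (l : ℕ) + H.nd < H.q →
      (C.rxIn w 0 t + C.rxIn w 1 t) l = 0 := by
    intro w t l hl
    rw [rxIn_add_rxIn, Pi.add_apply, link_apply_eq_zero le_rfl _ l hl,
      link_apply_eq_zero hw _ l hl, add_zero]
  have e2 : ∀ t, C.rxIn w 1 t = C.rxIn w' 1 t := fun t => by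
    have := eq_of_bottom_segment_eq (h2 t) (hz w t) (hz w' t)
    rw [e1 t] at this
    exact add_left_cancel this
  exact ext_pair (good_ext hg hg' 0 e1) (good_ext hg hg' 1 e2)

/-- A receiver that is given the received signal of the relay. -/
theorem card_good_le_relay_genie (C : H.Code n W) (hw : H.nc ≤ H.nd) :
    Nat.card C.good ≤ 2 ^ (n * (H.nd + max H.nd H.ns)) := by
  -- Bit budget: `ns` for the relay's input, `nd` for receiver `0`'s input without the relay part,
  -- and `nd - ns` for the levels of the other transmit signal that the relay does not see.
  have hm : H.nd + max H.nd H.ns = H.ns + (H.nd + (H.nd - H.ns)) := by omega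
  rw [hm]
  let f : (∀ i, W i) → (Fin n → Fin H.ns → ZMod 2) × (Fin n → Fin (H.nd + (H.nd - H.ns)) → ZMod 2) :=
    fun w =>
    (fun t => segment (H.q - H.ns) _ (C.relayIn w t),
     fun t => Fin.append
      (segment (H.q - H.nd) H.nd
        (H.link H.nd (C.enc 0 (w 0) t) + H.link H.nc (C.enc 1 (w 1) t)))
      (segment H.ns (H.nd - H.ns) (C.enc 1 (w 1) t)))
  refine card_le_of_injOn f ?_
  intro w hg w' hg' h
  simp only [f, Prod.mk.injEq, funext_iff (f := fun t : Fin n => segment _ _ _),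
    funext_iff (f := fun t : Fin n => Fin.append _ _)] at h
  obtain ⟨h1, h2⟩ := h
  have h3 : ∀ t, segment (H.q - H.nd) H.nd
        (H.link H.nd (C.enc 0 (w 0) t) + H.link H.nc (C.enc 1 (w 1) t)) =
      segment (H.q - H.nd) H.nd
        (H.link H.nd (C.enc 0 (w' 0) t) + H.link H.nc (C.enc 1 (w' 1) t)) := fun t => by
    funext j
    simpa using congrFun (h2 t) (Fin.castAdd _ j)
  have h4 : ∀ t, segment H.ns (H.nd - H.ns) (C.enc 1 (w 1) t) =
      segment H.ns (H.nd - H.ns) (C.enc 1 (w' 1) t) := fun t => by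
    funext j
    simpa using congrFun (h2 t) (Fin.natAdd _ j)
  have er : ∀ t, C.relayIn w t = C.relayIn w' t := fun t =>
    eq_of_bottom_segment_eq (h1 t)
      (fun l hl => by
        rw [relayIn, Pi.add_apply, link_apply_eq_zero le_rfl _ l hl,
          link_apply_eq_zero le_rfl _ l hl, add_zero])
      (fun l hl => by
        rw [relayIn, Pi.add_apply, link_apply_eq_zero le_rfl _ l hl,
          link_apply_eq_zero le_rfl _ l hl, add_zero])
  have eo : ∀ t, C.relayOut w t = C.relayOut w' t := fun t =>
    C.relayOut_congr t fun s _ => er s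
  have ed : ∀ t, H.link H.nd (C.enc 0 (w 0) t) + H.link H.nc (C.enc 1 (w 1) t) =
      H.link H.nd (C.enc 0 (w' 0) t) + H.link H.nc (C.enc 1 (w' 1) t) := fun t =>
    eq_of_bottom_segment_eq (h3 t)
      (fun l hl => by
        rw [Pi.add_apply, link_apply_eq_zero le_rfl _ l hl,
          link_apply_eq_zero hw _ l hl, add_zero])
      (fun l hl => by
        rw [Pi.add_apply, link_apply_eq_zero le_rfl _ l hl,
          link_apply_eq_zero hw _ l hl, add_zero])
  have e0 : w 0 = w' 0 := good_ext hg hg' 0 fun t => by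
    rw [rxIn_zero, rxIn_zero, ed t, eo t]
  have es : ∀ t, H.link H.ns (C.enc 1 (w 1) t) = H.link H.ns (C.enc 1 (w' 1) t) := fun t => by
    have := er t
    rw [relayIn, relayIn, e0] at this
    exact add_left_cancel this
  have et : ∀ t (a : Fin H.q), (a : ℕ) < H.nd → C.enc 1 (w 1) t a = C.enc 1 (w' 1) t a := by
    intro t a ha
    by_cases h : (a : ℕ) < H.ns
    · exact top_of_link_eq H.ns_le_q (es t) a h
    · exact eq_of_segment_eq (h4 t) a (by omega) (by omega)
  refine ext_pair e0 (good_ext hg hg' 1 fun t => ?_)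
  rw [rxIn_one, rxIn_one, e0, eo t, link_eq_of_top _ (et t)]

/-- A receiver that decodes its message, reconstructs the relay signal step by step, and is given
what it misses of the other transmit signal. -/
theorem card_good_le_successive (C : H.Code n W) (hw : H.nc ≤ H.nd) :
    Nat.card C.good ≤ 2 ^ (n * (max H.nd H.nr + (max H.nd H.ns - H.nc))) := by
  refine card_le_of_injOn (fun w =>
    (fun t => segment (H.q - max H.nd H.nr) _ (C.rxIn w 0 t),
     fun t => segment H.nc _ (C.enc 1 (w 1) t))) ?_
  intro w hg w' hg' h
  simp only [Prod.mk.injEq, funext_iff (f := fun t : Fin n => segment _ _ _)] at h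
  obtain ⟨h1, h2⟩ := h
  have e1 : ∀ t, C.rxIn w 0 t = C.rxIn w' 0 t := fun t =>
    eq_of_bottom_segment_eq (h1 t) (C.rxIn_apply_eq_zero w 0 t hw)
      (C.rxIn_apply_eq_zero w' 0 t hw)
  have e0 : w 0 = w' 0 := good_ext hg hg' 0 e1
  -- Past relay inputs fix the present relay output; removing it and the own signal from `y₀` leaves
  -- the top `nc` levels of `x₁`, and the genie supplies the levels from `nc` on.
  have step : ∀ t, (∀ s, s < t → C.relayIn w s = C.relayIn w' s) →
      ∀ a : Fin H.q, (a : ℕ) < max H.nd H.ns → C.enc 1 (w 1) t a = C.enc 1 (w' 1) t a := by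
    intro t ht a ha
    by_cases h : (a : ℕ) < H.nc
    · have := e1 t
      rw [rxIn_zero, rxIn_zero, C.relayOut_congr t ht, e0] at this
      exact top_of_link_eq H.nc_le_q (add_left_cancel (add_right_cancel this)) a h
    · exact eq_of_segment_eq (h2 t) a (by omega) (by omega)
  have er : ∀ t, C.relayIn w t = C.relayIn w' t := by
    intro t
    induction t using WellFoundedLT.induction with
    | ind t ih =>
      rw [relayIn, relayIn, e0,
        link_eq_of_top H.ns fun a ha => step t ih a (ha.trans_le (le_max_right _ _))]
  refine ext_pair e0 (good_ext hg hg' 1 fun t => ?_)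
  rw [rxIn_one, rxIn_one, e0, C.relayOut_congr t fun s _ => er s,
    link_eq_of_top H.nd fun a ha => step t (fun s _ => er s) a (ha.trans_le (le_max_left _ _))]

end Code

end LDIRC

/-! ### From counting bounds to rate bounds -/

namespace LDIRC

variable {H : LDIRC}

namespace Code

variable {n : ℕ} {W : Fin 2 → Type}

theorem card_le_two_mul_card_good (C : H.Code n W) [∀ i, Finite (W i)]
    (h : C.errorProb < 1 / 2) (hpos : 0 < Nat.card (∀ i, W i)) :
    Nat.card (∀ i, W i) ≤ 2 * Nat.card C.good := by
  classical
  have h1 : Nat.card {w : ∀ i, W i // ∃ i, C.decoded w i ≠ w i} + Nat.card C.good =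
      Nat.card (∀ i, W i) := by
    rw [← Nat.card_sum]
    have e : {w : ∀ i, W i // ∃ i, C.decoded w i ≠ w i} ⊕ C.good ≃
        {w : ∀ i, W i // ¬ ∀ i, C.decoded w i = w i} ⊕ {w : ∀ i, W i // ∀ i, C.decoded w i = w i} :=
      Equiv.sumCongr (Equiv.subtypeEquivRight fun w => by push Not; rfl) (Equiv.refl _)
    exact Nat.card_congr (e.trans ((Equiv.sumComm _ _).trans (Equiv.sumCompl _)))
  rw [errorProb, div_lt_iff₀ (by exact_mod_cast hpos)] at h
  have h2 : (2 * Nat.card {w : ∀ i, W i // ∃ i, C.decoded w i ≠ w i} : ℝ) <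
      Nat.card (∀ i, W i) := by linarith
  have h3 : 2 * Nat.card {w : ∀ i, W i // ∃ i, C.decoded w i ≠ w i} <
      Nat.card (∀ i, W i) := by exact_mod_cast h2
  omega

end Code

theorem half_le_floor {x : ℝ} (hx : 1 ≤ x) : x / 2 ≤ ⌊x⌋₊ := by
  have h1 : (1 : ℝ) ≤ ⌊x⌋₊ := by exact_mod_cast Nat.le_floor (by exact_mod_cast hx)
  have h2 := Nat.lt_floor_add_one x
  linarith

/-- If the number of correctly decoded message pairs is at most `2 ^ (n B)`, then `B` is an upper
bound on the sum-capacity. -/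
theorem mem_upperBounds_of_card_good_le {B : ℕ}
    (hB : ∀ (n : ℕ) (W : Fin 2 → Type) (C : H.Code n W), Nat.card C.good ≤ 2 ^ (n * B))
    {s : ℝ} (hs : s ∈ H.achievableSumRates) : s ≤ B := by
  obtain ⟨R, ⟨hR, C, hC⟩, rfl⟩ := hs
  by_contra! hlt
  have h1 : ∀ᶠ n : ℕ in atTop, (C n).errorProb < 1 / 2 := hC.eventually (gt_mem_nhds (by norm_num))
  -- The slack of three bits: one for each of the two floors, one for keeping only the good half of
  -- the message pairs.
  have h2 : ∀ᶠ n : ℕ in atTop, 3 / (R 0 + R 1 - B) < n :=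
    tendsto_natCast_atTop_atTop.eventually_gt_atTop _
  obtain ⟨n, hn1, hn2⟩ := (h1.and h2).exists
  rw [div_lt_iff₀ (by linarith)] at hn2
  have hx : ∀ i, (1 : ℝ) ≤ 2 ^ ((n : ℝ) * R i) := fun i =>
    Real.one_le_rpow (by norm_num) (mul_nonneg (Nat.cast_nonneg _) (hR i))
  have hcard : Nat.card (∀ i, Fin ⌊(2 : ℝ) ^ ((n : ℝ) * R i)⌋₊) =
      ⌊(2 : ℝ) ^ ((n : ℝ) * R 0)⌋₊ * ⌊(2 : ℝ) ^ ((n : ℝ) * R 1)⌋₊ := by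
    rw [Nat.card_pi, Fin.prod_univ_two, Nat.card_fin, Nat.card_fin]
  have hpos : ∀ i, 0 < ⌊(2 : ℝ) ^ ((n : ℝ) * R i)⌋₊ := fun i => Nat.floor_pos.2 (hx i)
  have h3 := ((C n).card_le_two_mul_card_good hn1
    (by rw [hcard]; exact Nat.mul_pos (hpos 0) (hpos 1))).trans
      (Nat.mul_le_mul_left 2 (hB n _ (C n)))
  rw [hcard] at h3
  have h4 : (⌊(2 : ℝ) ^ ((n : ℝ) * R 0)⌋₊ * ⌊(2 : ℝ) ^ ((n : ℝ) * R 1)⌋₊ : ℝ) ≤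
      2 * 2 ^ (n * B) := by exact_mod_cast h3
  have h5 := mul_le_mul (half_le_floor (hx 0)) (half_le_floor (hx 1))
    (by linarith [hx 1]) (Nat.cast_nonneg _)
  have h6 : (2 : ℝ) ^ ((n : ℝ) * R 0) * 2 ^ ((n : ℝ) * R 1) ≤ 2 ^ ((3 : ℝ) + n * B) := by
    rw [Real.rpow_add (by norm_num)]
    have : (2 : ℝ) ^ ((n : ℝ) * B) = 2 ^ (n * B) := by
      rw [← Real.rpow_natCast]; push_cast; rfl
    rw [this]
    norm_num
    linarith
  rw [← Real.rpow_add (by norm_num), Real.rpow_le_rpow_left_iff (by norm_num)] at h6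
  linarith

theorem Code.sumRate_le {n B : ℕ} {W : Fin 2 → Type} [∀ i, Finite (W i)] [∀ i, Nonempty (W i)]
    (C : H.Code n W) (hn : 0 < n) (hB : Nat.card C.good ≤ 2 ^ (n * B))
    (hC : ∀ w i, C.decoded w i = w i) : C.sumRate ≤ B := by
  have hg : C.good = Set.univ := Set.eq_univ_of_forall fun w i => hC w i
  rw [hg, Nat.card_coe_set_eq, Set.ncard_univ, Nat.card_pi] at hB
  rw [sumRate, div_le_iff₀ (by exact_mod_cast hn)]
  have hne : ∀ i, ((Nat.card (W i) : ℕ) : ℝ) ≠ 0 := fun i => by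
    exact_mod_cast Nat.card_pos.ne'
  rw [← Real.logb_prod _ _ fun i _ => hne i]
  have h2 : (∏ i, (Nat.card (W i) : ℝ)) ≤ 2 ^ ((B : ℝ) * n) := by
    rw [mul_comm, ← Nat.cast_mul, Real.rpow_natCast]
    exact_mod_cast hB
  rw [Real.logb_le_iff_le_rpow (by norm_num)
    (Finset.prod_pos fun i _ => by exact_mod_cast Nat.card_pos)]
  exact h2

end LDIRC

instance : DecidableEq Layer := fun a b => by
  cases a <;> cases b <;> first | exact isTrue rfl | exact isFalse nofun

instance : Fintype Layer :=
  ⟨{.cn, .df1, .df2, .cf, .p}, fun s => by cases s <;> decide⟩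

theorem WI1.le_of_achieves {H : LDIRC} {B : ℕ}
    (hB : ∀ (n : ℕ) (W : Fin 2 → Type) (C : H.Code n W), Nat.card C.good ≤ 2 ^ (n * B))
    {s : ℝ} (hs : WI1.Achieves H s) : s ≤ B := by
  obtain ⟨P, hP, C, hC, hlim⟩ := hs
  refine le_of_tendsto hlim ?_
  filter_upwards [eventually_gt_atTop 0] with K hK
  exact (C K).sumRate_le (Nat.mul_pos hK hP.T_pos) (hB _ _ _) (hC K).2

/-! ### Columns of the scheme and their linearity -/

namespace WI1

open Layer

variable {P : WI1} {K : ℕ}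

section Columns

variable {off len : ℕ}

theorem place_of_lt (v : Fin len → ZMod 2) {a : ℕ} (h : a < off) : place off v a = 0 :=
  dif_neg (by omega)

theorem place_of_ge (v : Fin len → ZMod 2) {a : ℕ} (h : off + len ≤ a) : place off v a = 0 :=
  dif_neg (by omega)

theorem place_offset_add (v : Fin len → ZMod 2) (b : Fin len) : place off v (off + b) = v b := by
  rw [place, dif_pos ⟨by omega, by omega⟩]
  congr
  omega

theorem place_zero (a : ℕ) : place off (0 : Fin len → ZMod 2) a = 0 := by
  simp [place]

theorem place_add (v v' : Fin len → ZMod 2) (a : ℕ) :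
    place off (v + v') a = place off v a + place off v' a := by
  unfold place
  split_ifs <;> simp

theorem place_sub (v v' : Fin len → ZMod 2) (a : ℕ) :
    place off (v - v') a = place off v a - place off v' a := by
  unfold place
  split_ifs <;> simp

theorem eq_zero_of_place_eq_zero {v : Fin len → ZMod 2}
    (h : ∀ b < len, place off v (off + b) = 0) : v = 0 := by
  funext b
  rw [← place_offset_add (off := off) v b]
  exact h b b.2

/-- The column `c`, shifted down by `s` levels. -/
def delay (s : ℕ) (c : ℕ → ZMod 2) (a : ℕ) : ZMod 2 := if s ≤ a then c (a - s) else 0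

/-- The offsets need to agree only for a nonempty vector, which matches the condition `0 < P.R cn`
in the alignment requirement. -/
theorem delay_place {s s' off' : ℕ} (v : Fin len → ZMod 2) (a : ℕ)
    (h : 0 < len → s + off = s' + off') :
    delay s (place off v) a = delay s' (place off' v) a := by
  unfold delay place
  rcases Nat.eq_zero_or_pos len with rfl | hl
  · simp
  · have := h hl
    split_ifs <;> first | rfl | omega | (congr 2; omega)

end Columns

theorem u_sub (w w' : P.Msg K) (s : Layer) (k : ℕ) :
    P.u (w - w') s k = P.u w s k - P.u w' s k := by
  unfold u
  split_ifs <;> simp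

theorem u_zero (w : P.Msg K) (s : Layer) : P.u w s 0 = 0 := dif_neg (by omega)

theorem u_of_ge (w : P.Msg K) (s : Layer) {k : ℕ} (h : K ≤ k) : P.u w s k = 0 :=
  dif_neg (by omega)

theorem eq_zero_of_u_eq_zero {w : P.Msg K} (h : ∀ k, k ≤ K → ∀ s, P.u w s k = 0) : w = 0 := by
  funext m s
  have h1 := h (m + 1) (by omega) s
  rw [u, dif_pos ⟨by omega, by omega⟩] at h1
  exact h1

theorem tx_sub (i : Fin 2) (w w' : P.Msg K) (k a : ℕ) :
    P.tx i (w - w') k a = P.tx i w k a - P.tx i w' k a := by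
  simp only [tx, u_sub, place_sub]
  ring

theorem relayTx_sub (w w' : Fin 2 → P.Msg K) (k a : ℕ) :
    P.relayTx (w - w') k a = P.relayTx w k a - P.relayTx w' k a := by
  simp only [relayTx, Pi.sub_apply, u_sub, place_sub, Fin.sum_univ_two]
  ring

/-- The relay part of a column seen from user `i`: own contributions plus those of the other. -/
theorem relayTx_eq (w : Fin 2 → P.Msg K) (i : Fin 2) (k a : ℕ) :
    P.relayTx w k a = place 0 (P.u (w i) cf (k - 1) + P.u (w (1 - i)) cf (k - 1)) a
      + (place (P.R cf) (P.u (w 0) df1 (k - 1)) a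
        + place (P.R cf + P.R df1) (P.u (w 1) df1 (k - 1)) a)
      + (place (P.R cf + 2 * P.R df1) (P.u (w 0) df2 (k - 1)) a
        + place (P.R cf + 2 * P.R df1 + P.R df2) (P.u (w 1) df2 (k - 1)) a)
      + place P.relayCnOffset (P.u (w i) cn (k - 1) + P.u (w (1 - i)) cn (k - 1)) a := by
  rw [relayTx, Fin.sum_univ_two]
  simp only [place_add, Fin.val_zero, Fin.val_one, zero_mul, one_mul, add_zero]
  fin_cases i
  · simp only [Fin.zero_eta, Fin.isValue, sub_zero]
    ring
  · simp only [Fin.mk_one, Fin.isValue, sub_self]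
    ring

/-- Bit-level conditions under which the relay can generate its column from the previous blocks
and both receivers can decode backwards over the blocks. -/
structure Decodable (P : WI1) (H : LDIRC) : Prop where
  weak : H.nc < H.nd
  relay_upper : P.l1 + P.R cn + P.R cf ≤ P.T * H.ns
  -- The current `cn` and `df2` vectors are the only ones below the private part that the relay has
  -- to read.
  relay_lower : (P.R cn = 0 ∧ P.R df2 = 0) ∨
    P.l1 + 2 * P.R cn + P.R cf + P.R p + 2 * P.R df2 ≤ P.T * H.ns
  rx_length : P.l1 + P.R cn + P.R cf + P.R p ≤ P.T * H.nd
  rx_relay : 0 < P.R cf + 2 * P.R df1 + 2 * P.R df2 →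
    P.R cf + 2 * P.R df1 + 2 * P.R df2 + P.T * H.nd ≤ P.T * H.nr + P.l1
  -- The interferer's private vector then arrives below the levels that a receiver has to read.
  private_length : P.R p + P.T * H.nc ≤ P.T * H.nd

/-! ### Forward decoding at the relay -/

section Relay

variable {H : LDIRC} (hA : P.Admissible H) (hD : P.Decodable H)

/-- What the relay knows about the information of block `k`, in the case that its received
signals vanish. -/
def RelaySilent (w : Fin 2 → P.Msg K) (k : ℕ) : Prop :=
  P.u (w 0) cn k + P.u (w 1) cn k = 0 ∧ P.u (w 0) cf k + P.u (w 1) cf k = 0 ∧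
    ∀ i, P.u (w i) df1 k = 0 ∧ P.u (w i) df2 k = 0

include hA hD in
-- The previous `cn` sum is already known, so removing it uncovers `df1`. All layers then occupy
-- disjoint levels, and within a decode-forward vector the users occupy disjoint halves, so each
-- piece is read off separately.
theorem RelaySilent.succ {w : Fin 2 → P.Msg K} {k : ℕ} (hk : RelaySilent w k)
    (h : ∀ a < P.T * H.ns, P.tx 0 (w 0) (k + 1) a + P.tx 1 (w 1) (k + 1) a = 0) :
    RelaySilent w (k + 1) := by
  have h1 := hD.relay_upper
  have h2 := hD.relay_lower
  have h3 := hA.df1_le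
  have hcn : ∀ a, place P.l1 (P.u (w 0) cn k) a + place P.l1 (P.u (w 1) cn k) a = 0 := fun a => by
    rw [← place_add, hk.1, place_zero]
  have key : ∀ a < P.T * H.ns,
      (place P.l1 (P.u (w 0) df1 (k + 1)) a + place (P.l1 + P.R df1) (P.u (w 1) df1 (k + 1)) a)
      + place (P.l1 + P.R cn) (P.u (w 0) cf (k + 1) + P.u (w 1) cf (k + 1)) a
      + place (P.l1 + P.R cn + P.R cf) (P.u (w 0) p (k + 1) + P.u (w 1) p (k + 1)) a
      + place (P.l1 + P.R cn + P.R cf + P.R p) (P.u (w 0) cn (k + 1) + P.u (w 1) cn (k + 1)) a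
      + (place (P.l1 + P.R cn + P.R cf + P.R p + P.R cn) (P.u (w 0) df2 (k + 1)) a
        + place (P.l1 + P.R cn + P.R cf + P.R p + P.R cn + P.R df2) (P.u (w 1) df2 (k + 1)) a)
      = 0 := by
    intro a ha
    rw [← h a ha, tx, tx]
    simp only [place_add, Nat.add_sub_cancel, Fin.val_zero, Fin.val_one, zero_mul, one_mul,
      add_zero]
    linear_combination -hcn a
  refine ⟨?_, ?_, ?_⟩
  · refine eq_zero_of_place_eq_zero (off := P.l1 + P.R cn + P.R cf + P.R p) fun b hb => ?_
    have := key _ (show P.l1 + P.R cn + P.R cf + P.R p + b < _ by omega)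
    simpa (disch := omega) only [place_of_lt, place_of_ge, add_zero, zero_add] using this
  · refine eq_zero_of_place_eq_zero (off := P.l1 + P.R cn) fun b hb => ?_
    have := key _ (show P.l1 + P.R cn + b < _ by omega)
    simpa (disch := omega) only [place_of_lt, place_of_ge, add_zero, zero_add] using this
  · have d10 : P.u (w 0) df1 (k + 1) = 0 := by
      refine eq_zero_of_place_eq_zero (off := P.l1) fun b hb => ?_
      have := key _ (show P.l1 + b < _ by omega)
      simpa (disch := omega) only [place_of_lt, place_of_ge, add_zero, zero_add] using this
    have d11 : P.u (w 1) df1 (k + 1) = 0 := by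
      refine eq_zero_of_place_eq_zero (off := P.l1 + P.R df1) fun b hb => ?_
      have := key _ (show P.l1 + P.R df1 + b < _ by omega)
      simpa (disch := omega) only [place_of_lt, place_of_ge, add_zero, zero_add] using this
    have d20 : P.u (w 0) df2 (k + 1) = 0 := by
      refine eq_zero_of_place_eq_zero (off := P.l1 + P.R cn + P.R cf + P.R p + P.R cn)
        fun b hb => ?_
      have := key _ (show P.l1 + P.R cn + P.R cf + P.R p + P.R cn + b < _ by omega)
      simpa (disch := omega) only [place_of_lt, place_of_ge, add_zero, zero_add] using this
    have d21 : P.u (w 1) df2 (k + 1) = 0 := by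
      refine eq_zero_of_place_eq_zero (off := P.l1 + P.R cn + P.R cf + P.R p + P.R cn + P.R df2)
        fun b hb => ?_
      have := key _ (show P.l1 + P.R cn + P.R cf + P.R p + P.R cn + P.R df2 + b < _ by omega)
      simpa (disch := omega) only [place_of_lt, place_of_ge, add_zero, zero_add] using this
    intro i
    fin_cases i
    · exact ⟨d10, d20⟩
    · exact ⟨d11, d21⟩

include hA hD in
/-- If the relay receives nothing before block `k + 1`, then it sends nothing in that block. -/
theorem relayTx_eq_zero {w : Fin 2 → P.Msg K} {k : ℕ}
    (h : ∀ j < k, ∀ a < P.T * H.ns, P.tx 0 (w 0) (j + 1) a + P.tx 1 (w 1) (j + 1) a = 0)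
    (a : ℕ) : P.relayTx w (k + 1) a = 0 := by
  have hs : ∀ j ≤ k, RelaySilent w j := by
    intro j hj
    induction j with
    | zero => simp [RelaySilent, u_zero]
    | succ j ih => exact (ih (by omega)).succ hA hD (h j (by omega))
  obtain ⟨h1, h2, h3⟩ := hs k le_rfl
  rw [relayTx_eq w 0, Nat.add_sub_cancel, sub_zero, h1, h2, (h3 0).1, (h3 0).2, (h3 1).1, (h3 1).2]
  simp only [place_zero, add_zero]

end Relay

/-! ### Backward decoding at the receivers -/

section Receiver

variable {H : LDIRC} (hA : P.Admissible H) (hD : P.Decodable H)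

/-- What receiver `i` learns about the information of block `k` from the later blocks, in the case
that its received signals vanish. -/
def ReceiverSilent (w : Fin 2 → P.Msg K) (i : Fin 2) (k : ℕ) : Prop :=
  P.u (w i) cn k = 0 ∧ P.u (w i) cf k + P.u (w (1 - i)) cf k = 0 ∧
    ∀ j, P.u (w j) df1 k = 0 ∧ P.u (w j) df2 k = 0

/-- The column that receiver `i` receives in block `k`. -/
def rx (P : WI1) (H : LDIRC) (w : Fin 2 → P.Msg K) (i : Fin 2) (k a : ℕ) : ZMod 2 :=
  delay (P.T * (H.q - H.nd)) (P.tx i (w i) k) a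
    + delay (P.T * (H.q - H.nc)) (P.tx (1 - i) (w (1 - i)) k) a
    + delay (P.T * (H.q - H.nr)) (P.relayTx w k) a

include hA hD in
-- Block `k + 1` carries the previous `cn` vectors and the relay's functions of block `k`, so what
-- is known about block `k + 1` from later blocks can be traded for the same knowledge about block
-- `k`. The `cf` and private vectors of block `k + 1` come out on the way.
theorem ReceiverSilent.pred {w : Fin 2 → P.Msg K} {i : Fin 2} {k : ℕ}
    (hk : ReceiverSilent w i (k + 1)) (h : ∀ a < P.T * H.q, P.rx H w i (k + 1) a = 0) :
    ReceiverSilent w i k ∧ P.u (w i) cf (k + 1) = 0 ∧ P.u (w i) Layer.p (k + 1) = 0 := by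
  obtain ⟨hcn, hcf, hdf⟩ := hk
  have b2 := hD.rx_length
  have b3 := hD.rx_relay
  have b4 := hD.private_length
  have b5 := hA.aligned
  have b6 := hA.df1_le
  have hT := hA.T_pos
  have q1 := Nat.mul_le_mul_left P.T H.nd_le_q
  have q2 := Nat.mul_le_mul_left P.T H.nc_le_q
  have q3 := Nat.mul_le_mul_left P.T H.nr_le_q
  have q4 := Nat.mul_lt_mul_of_pos_left hD.weak hT
  have hoff : P.relayCnOffset = P.R cf + 2 * P.R df1 + 2 * P.R df2 + P.l2 := rfl
  simp only [rx, Nat.mul_sub] at h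
  generalize P.T * H.nd = Nd at *
  generalize P.T * H.nc = Nc at *
  generalize P.T * H.nr = Nr at *
  generalize P.T * H.q = Q at *
  set c := P.u (w i) cn k with hc
  set c' := P.u (w (1 - i)) cn k with hc'
  set f := P.u (w i) cf (k + 1) with hf
  set g := P.u (w i) Layer.p (k + 1) with hg
  -- Since the `cf` sum vanishes, the interfering `cf` vector is a copy of the desired one.
  have hf' : P.u (w (1 - i)) cf (k + 1) = f := by
    funext b
    have hb : f b + P.u (w (1 - i)) cf (k + 1) b = 0 := congrFun hcf b
    exact (CharTwo.add_eq_zero.1 hb).symm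
  -- the signals, up to what is known already
  let X : ℕ → ZMod 2 := fun a =>
    place P.l1 c a + place (P.l1 + P.R cn) f a + place (P.l1 + P.R cn + P.R cf) g a
  have htx : ∀ a, P.tx i (w i) (k + 1) a = X a := by
    intro a
    simp only [tx, X, hcn, (hdf i).1, (hdf i).2, place_zero, add_zero, Nat.add_sub_cancel, ← hc,
      ← hf, ← hg]
  -- The cut-off excludes the interferer's private and current `cn` vectors, about which nothing is
  -- known.
  have htx' : ∀ a < P.l1 + P.R cn + P.R cf, P.tx (1 - i) (w (1 - i)) (k + 1) a =
      place P.l1 c' a + place (P.l1 + P.R cn) f a := by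
    intro a ha
    simp only [tx, (hdf (1 - i)).1, (hdf (1 - i)).2, place_zero, add_zero, Nat.add_sub_cancel,
      ← hc', hf']
    simp (disch := omega) only [place_of_lt, add_zero]
  have hX0 : ∀ a < P.l1, X a = 0 := by
    intro a ha
    simp (disch := omega) only [X, place_of_lt, add_zero]
  -- the upper part of the relay signal
  have hup : ∀ a < P.R cf + 2 * P.R df1 + 2 * P.R df2, P.relayTx w (k + 1) a = 0 := by
    intro a ha
    have b3' := b3 (by omega)
    have := h (Q - Nr + a) (by omega)
    rw [delay, delay, delay, if_pos (show Q - Nr ≤ Q - Nr + a by omega), Nat.add_sub_cancel_left] at this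
    -- By `rx_relay`, these relay levels arrive above the first nonzero level of the desired signal,
    -- and a fortiori of the weaker cross signal.
    have z1 : (if Q - Nd ≤ Q - Nr + a then P.tx i (w i) (k + 1) (Q - Nr + a - (Q - Nd)) else 0)
        = 0 := by
      split_ifs
      · rw [htx, hX0 _ (by omega)]
      · rfl
    have z2 : (if Q - Nc ≤ Q - Nr + a then
        P.tx (1 - i) (w (1 - i)) (k + 1) (Q - Nr + a - (Q - Nc)) else 0) = 0 := by
      split_ifs
      · rw [htx' _ (by omega)]
        simp (disch := omega) only [place_of_lt, add_zero]
      · rfl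
    rwa [z1, z2, zero_add, zero_add] at this
  simp only [relayTx_eq w i, Nat.add_sub_cancel] at hup
  have e1 : P.u (w i) cf k + P.u (w (1 - i)) cf k = 0 := by
    refine eq_zero_of_place_eq_zero (off := 0) fun b hb => ?_
    have := hup _ (show 0 + b < _ by omega)
    simpa (disch := omega) only [place_of_lt, place_of_ge, add_zero] using this
  have e2 : P.u (w 0) df1 k = 0 := by
    refine eq_zero_of_place_eq_zero (off := P.R cf) fun b hb => ?_
    have := hup _ (show P.R cf + b < _ by omega)
    simpa (disch := omega) only [place_of_lt, place_of_ge, add_zero, zero_add] using this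
  have e3 : P.u (w 1) df1 k = 0 := by
    refine eq_zero_of_place_eq_zero (off := P.R cf + P.R df1) fun b hb => ?_
    have := hup _ (show P.R cf + P.R df1 + b < _ by omega)
    simpa (disch := omega) only [place_of_lt, place_of_ge, add_zero, zero_add] using this
  have e4 : P.u (w 0) df2 k = 0 := by
    refine eq_zero_of_place_eq_zero (off := P.R cf + 2 * P.R df1) fun b hb => ?_
    have := hup _ (show P.R cf + 2 * P.R df1 + b < _ by omega)
    simpa (disch := omega) only [place_of_lt, place_of_ge, add_zero, zero_add] using this
  have e5 : P.u (w 1) df2 k = 0 := by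
    refine eq_zero_of_place_eq_zero (off := P.R cf + 2 * P.R df1 + P.R df2) fun b hb => ?_
    have := hup _ (show P.R cf + 2 * P.R df1 + P.R df2 + b < _ by omega)
    simpa (disch := omega) only [place_of_lt, place_of_ge, add_zero, zero_add] using this
  have hrel : P.relayTx w (k + 1) = place P.relayCnOffset (c + c') := by
    funext a
    rw [relayTx_eq w i, Nat.add_sub_cancel, e1, e2, e3, e4, e5]
    simp only [place_zero, zero_add, ← hc, ← hc']
  -- the interference is a delayed copy of the desired signal
  have hX : ∀ a, a < P.l1 + P.R cn + P.R cf + P.R Layer.p → X a = 0 := by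
    intro a
    induction a using Nat.strong_induction_on with
    | _ a ih =>
      intro ha
      have := h (Q - Nd + a) (by omega)
      -- Alignment moves `c + c'` onto the levels of the interfering `c'`; the sum there is `c`, the
      -- desired vector.
      rw [hrel, delay_place (s' := Q - Nc) (off' := P.l1) _ _ (by omega), delay, delay, delay,
        if_pos (show Q - Nd ≤ Q - Nd + a by omega), Nat.add_sub_cancel_left, htx] at this
      by_cases hd : Q - Nc ≤ Q - Nd + a
      · rw [if_pos hd, if_pos hd, htx' _ (by omega), place_add] at this
        -- This index is `a - (Nd - Nc)`, smaller than `a` by weak interference; `private_length`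
        -- keeps it above the private part.
        have hi := ih (Q - Nd + a - (Q - Nc)) (by omega) (by omega)
        simp (disch := omega) only [X, place_of_lt (off := P.l1 + P.R cn + P.R cf),
          add_zero] at hi
        have hch := CharTwo.add_self_eq_zero (place P.l1 c' (Q - Nd + a - (Q - Nc)))
        linear_combination this - hi - hch
      · rwa [if_neg hd, if_neg hd, add_zero, add_zero] at this
  simp only [X] at hX
  refine ⟨⟨?_, e1, fun j => ?_⟩, ?_, ?_⟩
  · refine eq_zero_of_place_eq_zero (off := P.l1) fun b hb => ?_
    have := hX _ (show P.l1 + b < _ by omega)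
    simpa (disch := omega) only [place_of_lt, place_of_ge, add_zero, zero_add] using this
  · fin_cases j
    · exact ⟨e2, e4⟩
    · exact ⟨e3, e5⟩
  · refine eq_zero_of_place_eq_zero (off := P.l1 + P.R cn) fun b hb => ?_
    have := hX _ (show P.l1 + P.R cn + b < _ by omega)
    simpa (disch := omega) only [place_of_lt, place_of_ge, add_zero, zero_add] using this
  · refine eq_zero_of_place_eq_zero (off := P.l1 + P.R cn + P.R cf) fun b hb => ?_
    have := hX _ (show P.l1 + P.R cn + P.R cf + b < _ by omega)
    simpa (disch := omega) only [place_of_lt, place_of_ge, add_zero, zero_add] using this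

include hA hD in
/-- A message pair for which receiver `i` receives nothing has a vanishing message of user `i`. -/
theorem eq_zero_of_rx_eq_zero {w : Fin 2 → P.Msg K} {i : Fin 2}
    (h : ∀ k < K, ∀ a < P.T * H.q, P.rx H w i (k + 1) a = 0) : w i = 0 := by
  have hs : ∀ k ≤ K, ReceiverSilent w i k := by
    intro k hk
    induction hk using Nat.decreasingInduction with
    -- The backward induction starts at index `K`, where no fresh information is sent.
    | self => simp [ReceiverSilent, u_of_ge]
    | of_succ k hk ih => exact (ih.pred hA hD (h k hk)).1
  refine eq_zero_of_u_eq_zero fun k hk s => ?_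
  rcases k with _ | k
  · exact u_zero _ _
  · have h1 := hs _ hk
    have h2 := (h1.pred hA hD (h k hk)).2
    cases s
    · exact h1.1
    · exact (h1.2.2 i).1
    · exact (h1.2.2 i).2
    · exact h2.1
    · exact h2.2

end Receiver

end WI1

/-! ### From columns to codes over channel uses -/

namespace WI1

open Layer

variable {P : WI1} {H : LDIRC} {K : ℕ}

theorem add_mod_lt {a b T r : ℕ} (hab : a < b) (hr : r < T) : a * T + r < b * T := by
  have := Nat.mul_le_mul_right T hab
  rw [Nat.succ_mul] at this
  omega

/-- A link acts on the column of a block as a shift by a multiple of `T`. -/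
theorem link_eq_delay (H : LDIRC) (m : ℕ) {T r : ℕ} (hr : r < T) (c : ℕ → ZMod 2)
    (l : Fin H.q) :
    H.link m (fun l => c (l * T + r)) l = delay (T * (H.q - m)) c (l * T + r) := by
  rw [LDIRC.link_apply, delay]
  by_cases h : H.q - m ≤ (l : ℕ)
  · have h1 : (l : ℕ) * T = ((l : ℕ) - (H.q - m)) * T + T * (H.q - m) := by
      rw [mul_comm T, ← Nat.add_mul, Nat.sub_add_cancel h]
    rw [dif_pos h, if_pos (by omega)]
    congr 1
    simp only
    omega
  · have h1 := add_mod_lt (not_le.1 h) hr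
    rw [mul_comm T, dif_neg h, if_neg (by omega)]

/-- The vector sent by transmitter `i` in channel use `t`. -/
def txVec (P : WI1) (H : LDIRC) (i : Fin 2) (w : P.Msg K) (t : ℕ) : H.Vec := fun l =>
  P.tx i w (t / P.T + 1) (l * P.T + t % P.T)

/-- The vector sent by the relay in channel use `t`. -/
def relayVec (P : WI1) (H : LDIRC) (w : Fin 2 → P.Msg K) (t : ℕ) : H.Vec := fun l =>
  P.relayTx w (t / P.T + 1) (l * P.T + t % P.T)

/-- The vector received by the relay in channel use `t`. -/
def relayRxVec (P : WI1) (H : LDIRC) (w : Fin 2 → P.Msg K) (t : ℕ) : H.Vec :=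
  H.link H.ns (P.txVec H 0 (w 0) t) + H.link H.ns (P.txVec H 1 (w 1) t)

/-- The vector received by receiver `i` in channel use `t`. -/
def rxVec (P : WI1) (H : LDIRC) (w : Fin 2 → P.Msg K) (i : Fin 2) (t : ℕ) : H.Vec :=
  H.link H.nd (P.txVec H i (w i) t) + H.link H.nc (P.txVec H (1 - i) (w (1 - i)) t)
    + H.link H.nr (P.relayVec H w t)

theorem txVec_sub (i : Fin 2) (w w' : P.Msg K) (t : ℕ) :
    P.txVec H i (w - w') t = P.txVec H i w t - P.txVec H i w' t := by
  funext l
  exact tx_sub _ _ _ _ _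

theorem relayVec_sub (w w' : Fin 2 → P.Msg K) (t : ℕ) :
    P.relayVec H (w - w') t = P.relayVec H w t - P.relayVec H w' t := by
  funext l
  exact relayTx_sub _ _ _ _

theorem link_sub (m : ℕ) (x y : H.Vec) : H.link m (x - y) = H.link m x - H.link m y :=
  Matrix.mulVec_sub _ _ _

theorem relayRxVec_sub (w w' : Fin 2 → P.Msg K) (t : ℕ) :
    P.relayRxVec H (w - w') t = P.relayRxVec H w t - P.relayRxVec H w' t := by
  simp only [relayRxVec, Pi.sub_apply, txVec_sub, link_sub]
  abel

theorem rxVec_sub (w w' : Fin 2 → P.Msg K) (i : Fin 2) (t : ℕ) :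
    P.rxVec H (w - w') i t = P.rxVec H w i t - P.rxVec H w' i t := by
  simp only [rxVec, Pi.sub_apply, txVec_sub, relayVec_sub, link_sub]
  abel

theorem block_div {T k r : ℕ} (hr : r < T) : (k * T + r) / T = k := by
  rw [mul_comm, Nat.mul_add_div (by omega), Nat.div_eq_of_lt hr, add_zero]

theorem block_mod {T k r : ℕ} (hr : r < T) : (k * T + r) % T = r := by
  rw [Nat.mul_add_mod', Nat.mod_eq_of_lt hr]

theorem relayVec_congr (hA : P.Admissible H) (hD : P.Decodable H) {w w' : Fin 2 → P.Msg K}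
    {t : ℕ} (h : ∀ s < t, P.relayRxVec H w s = P.relayRxVec H w' s) :
    P.relayVec H w t = P.relayVec H w' t := by
  have hT := hA.T_pos
  rw [← sub_eq_zero, ← relayVec_sub]
  funext l
  refine relayTx_eq_zero hA hD (fun j hj a ha => ?_) _
  have hr := Nat.mod_lt a hT
  -- Only complete blocks before that of `t` are needed, so every channel use consulted precedes
  -- `t`.
  have hs : j * P.T + a % P.T < t :=
    (add_mod_lt hj hr).trans_le (Nat.div_mul_le_self t P.T)
  have hz : P.relayRxVec H (w - w') (j * P.T + a % P.T) = 0 := by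
    rw [relayRxVec_sub, h _ hs, sub_self]
  have hq := H.ns_le_q
  have hl : a / P.T < H.ns := (Nat.div_lt_iff_lt_mul hT).2 (by rwa [mul_comm] at ha)
  have hz' := congrFun hz ⟨a / P.T + (H.q - H.ns), by omega⟩
  simp only [relayRxVec, Pi.add_apply, LDIRC.link_apply] at hz'
  rw [dif_pos (Nat.le_add_left _ _), dif_pos (Nat.le_add_left _ _)] at hz'
  simp only [txVec, Nat.add_sub_cancel, block_div hr, block_mod hr, Nat.div_add_mod'] at hz'
  exact hz'

theorem relayVec_zero (hA : P.Admissible H) (hD : P.Decodable H) (w : Fin 2 → P.Msg K) :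
    P.relayVec H w 0 = 0 := by
  funext l
  rw [relayVec, Nat.zero_div]
  exact relayTx_eq_zero hA hD (by simp) _

theorem rxVec_injective (hA : P.Admissible H) (hD : P.Decodable H) {w w' : Fin 2 → P.Msg K}
    {i : Fin 2} (h : ∀ t < K * P.T, P.rxVec H w i t = P.rxVec H w' i t) : w i = w' i := by
  have hT := hA.T_pos
  rw [← sub_eq_zero, ← Pi.sub_apply]
  refine eq_zero_of_rx_eq_zero hA hD fun k hk a ha => ?_
  have hr := Nat.mod_lt a hT
  have hz : P.rxVec H (w - w') i (k * P.T + a % P.T) = 0 := by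
    rw [rxVec_sub, h _ (add_mod_lt hk hr), sub_self]
  have hl : a / P.T < H.q := (Nat.div_lt_iff_lt_mul hT).2 (by rwa [mul_comm] at ha)
  have hz' := congrFun hz ⟨a / P.T, hl⟩
  unfold rxVec txVec relayVec at hz'
  simp only [Pi.add_apply, block_div hr, block_mod hr] at hz'
  rw [link_eq_delay H _ hr (P.tx i ((w - w') i) (k + 1)),
    link_eq_delay H _ hr (P.tx (1 - i) ((w - w') (1 - i)) (k + 1)),
    link_eq_delay H _ hr (P.relayTx (w - w') (k + 1))] at hz'
  simp only [Nat.div_add_mod'] at hz'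
  exact hz'

open Classical in
/-- The WI-1 code over `K` blocks: the relay and the receivers look for messages that explain what
they have received. -/
def code (P : WI1) (H : LDIRC) (K : ℕ) : H.Code (K * P.T) (fun _ => P.Msg K) where
  enc i w t := P.txVec H i w t
  relay t y :=
    if h : ∃ w : Fin 2 → P.Msg K, ∀ s : Fin t, P.relayRxVec H w s = y s then
      P.relayVec H h.choose t else 0
  dec i y :=
    if h : ∃ w : Fin 2 → P.Msg K, ∀ t : Fin (K * P.T), P.rxVec H w i t = y t then h.choose i else 0

/-- The true messages always explain the relay's input. The explanation chosen may differ from them,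
but it yields the same relay vector by `relayVec_congr`. -/
theorem code_relayOut (hA : P.Admissible H) (hD : P.Decodable H) (w : Fin 2 → P.Msg K)
    (t : Fin (K * P.T)) : (P.code H K).relayOut w t = P.relayVec H w t := by
  rw [LDIRC.Code.relayOut]
  split_ifs with h0
  · rw [h0, relayVec_zero hA hD]
  · have h : ∃ w' : Fin 2 → P.Msg K, ∀ s : Fin t, P.relayRxVec H w' s =
        (P.code H K).relayIn w ⟨s, s.2.trans t.2⟩ := ⟨w, fun s => rfl⟩
    refine (dif_pos h).trans (relayVec_congr hA hD fun s hs => ?_)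
    exact h.choose_spec ⟨s, hs⟩

theorem code_rxIn (hA : P.Admissible H) (hD : P.Decodable H) (w : Fin 2 → P.Msg K) (i : Fin 2)
    (t : Fin (K * P.T)) : (P.code H K).rxIn w i t = P.rxVec H w i t := by
  rw [LDIRC.Code.rxIn, code_relayOut hA hD]
  rfl

theorem code_decoded (hA : P.Admissible H) (hD : P.Decodable H) (w : Fin 2 → P.Msg K)
    (i : Fin 2) : (P.code H K).decoded w i = w i := by
  have h : ∃ w' : Fin 2 → P.Msg K, ∀ t : Fin (K * P.T), P.rxVec H w' i t =
      (P.code H K).rxIn w i t := ⟨w, fun t => (code_rxIn hA hD w i t).symm⟩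
  refine (dif_pos h).trans (rxVec_injective hA hD fun t ht => ?_)
  rw [h.choose_spec ⟨t, ht⟩, code_rxIn hA hD]

theorem code_isCode (hA : P.Admissible H) (hD : P.Decodable H) :
    P.IsCode H K (P.code H K) :=
  ⟨fun _ _ _ _ => rfl, fun w t l => by rw [code_relayOut hA hD]; rfl⟩

/-- The number of information bits of a user per block. -/
def bits (P : WI1) : ℕ := P.R cn + P.R df1 + P.R df2 + P.R cf + P.R p

theorem card_msg (P : WI1) (K : ℕ) : Nat.card (P.Msg K) = 2 ^ ((K - 1) * P.bits) := by
  have h : ∀ f : Layer → ℕ, ∏ s, f s = f cn * f df1 * f df2 * f cf * f p := by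
    intro f
    change ∏ s ∈ ({Layer.cn, Layer.df1, Layer.df2, Layer.cf, Layer.p} : Finset Layer), f s = _
    rw [Finset.prod_insert (by simp), Finset.prod_insert (by simp), Finset.prod_insert (by simp),
      Finset.prod_insert (by simp), Finset.prod_singleton]
    ring
  simp only [Nat.card_eq_fintype_card, Fintype.card_pi, Finset.prod_const, Finset.card_univ,
    Fintype.card_fin, ZMod.card, h, bits]
  ring

theorem achieves_of_decodable (hA : P.Admissible H) (hD : P.Decodable H) :
    Achieves H (2 * P.bits / P.T) := by
  refine ⟨P, hA, P.code H, fun K => ⟨code_isCode hA hD, code_decoded hA hD⟩, ?_⟩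
  have hT : (P.T : ℝ) ≠ 0 := by exact_mod_cast hA.T_pos.ne'
  have h1 : Tendsto (fun K : ℕ => (2 * P.bits / P.T : ℝ) * (1 - 1 / (K : ℝ))) atTop
      (𝓝 (2 * P.bits / P.T * (1 - 0))) :=
    (tendsto_const_nhds.sub tendsto_one_div_atTop_nhds_zero_nat).const_mul _
  rw [sub_zero, mul_one] at h1
  refine h1.congr' ?_
  filter_upwards [eventually_ge_atTop 1] with K hK
  have hK' : (K : ℝ) ≠ 0 := by positivity
  rw [LDIRC.Code.sumRate, Fin.sum_univ_two, card_msg]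
  push_cast
  rw [Real.logb_pow, Real.logb_self_eq_one (by norm_num)]
  push_cast [Nat.cast_sub hK]
  field_simp
  ring

end WI1

/-! ### Achievable rate pairs from the scheme -/

namespace LDIRC

variable {H : LDIRC}

/-- An error-free code can be used for smaller message sets and, with zero padding, for a larger
number of channel uses. -/
theorem Code.exists_of_injective {n m : ℕ} {M W : Fin 2 → Type} [∀ i, Nonempty (W i)]
    (C : H.Code m M) (hC : ∀ w i, C.decoded w i = w i) (hmn : m ≤ n) (e : ∀ i, W i → M i)
    (he : ∀ i, Function.Injective (e i)) :
    ∃ C' : H.Code n W, ∀ w i, C'.decoded w i = w i := by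
  let C' : H.Code n W :=
    { enc := fun i w t => if h : (t : ℕ) < m then C.enc i (e i w) ⟨t, h⟩ else 0
      relay := fun t y => if h : (t : ℕ) < m then C.relay ⟨t, h⟩ y else 0
      dec := fun i y => Function.invFun (e i) (C.dec i fun t => y (Fin.castLE hmn t)) }
  refine ⟨C', fun w i => ?_⟩
  have henc : ∀ i (v : W i) (t : Fin m), C'.enc i v (Fin.castLE hmn t) = C.enc i (e i v) t :=
    fun i v t => dif_pos t.2
  have hin : ∀ t : Fin m, C'.relayIn w (Fin.castLE hmn t) = C.relayIn (fun j => e j (w j)) t :=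
    fun t => by rw [relayIn, relayIn, henc, henc]
  have hout : ∀ t : Fin m, C'.relayOut w (Fin.castLE hmn t) =
      C.relayOut (fun j => e j (w j)) t := by
    intro t
    unfold relayOut
    simp only [Fin.val_castLE]
    split_ifs with h
    · rfl
    · refine (dif_pos t.2).trans ?_
      congr 1
      funext s
      exact hin ⟨s, s.2.trans t.2⟩
  have hrx : ∀ t : Fin m, C'.rxIn w i (Fin.castLE hmn t) = C.rxIn (fun j => e j (w j)) i t :=
    fun t => by rw [rxIn, rxIn, henc, henc, hout]
  change Function.invFun (e i) (C.dec i fun t => C'.rxIn w i (Fin.castLE hmn t)) = w i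
  rw [funext hrx]
  have := hC (fun j => e j (w j)) i
  rw [decoded] at this
  rw [this]
  exact Function.leftInverse_invFun (he i) (w i)

theorem Code.errorProb_eq_zero {n : ℕ} {W : Fin 2 → Type} (C : H.Code n W)
    (hC : ∀ w i, C.decoded w i = w i) : C.errorProb = 0 := by
  have : IsEmpty {w : ∀ i, W i // ∃ i, C.decoded w i ≠ w i} :=
    ⟨fun ⟨w, i, hi⟩ => hi (hC w i)⟩
  rw [errorProb, Nat.card_of_isEmpty, Nat.cast_zero, zero_div]

/-- Each user can have any rate below the one of a decodable WI-1 scheme. -/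
theorem achievable_of_decodable {P : WI1} (hA : P.Admissible H) (hD : P.Decodable H) {ρ : ℝ}
    (h0 : 0 ≤ ρ) (hρ : ρ < P.bits / P.T) : H.Achievable fun _ => ρ := by
  refine ⟨fun _ => h0, ?_⟩
  have hT : (0 : ℝ) < P.T := by exact_mod_cast hA.T_pos
  have hne : ∀ (n : ℕ) (i : Fin 2), Nonempty (Fin ⌊(2 : ℝ) ^ ((n : ℝ) * ρ)⌋₊) := fun n _ =>
    ⟨⟨0, Nat.floor_pos.2 (Real.one_le_rpow (by norm_num) (by positivity))⟩⟩
  have hev : ∀ᶠ n : ℕ in atTop,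
      ∃ C : H.Code n (fun _ => Fin ⌊(2 : ℝ) ^ ((n : ℝ) * ρ)⌋₊), ∀ w i, C.decoded w i = w i := by
    -- Up to two blocks' worth of bits are lost: one by rounding `n / P.T` down, one because the
    -- last block carries no fresh information.
    have h2 : ∀ᶠ n : ℕ in atTop, 2 * P.bits / (P.bits / P.T - ρ) < n :=
      tendsto_natCast_atTop_atTop.eventually_gt_atTop _
    filter_upwards [h2, eventually_ge_atTop P.T] with n hn hnT
    rw [div_lt_iff₀ (by linarith)] at hn
    have hK : 1 ≤ n / P.T := (Nat.one_le_div_iff hA.T_pos).2 hnT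
    have hKn : (n : ℝ) / P.T - 1 ≤ (n / P.T : ℕ) := by
      have h3 := Nat.lt_div_mul_add (a := n) hA.T_pos
      have h4 : (n : ℝ) < (n / P.T : ℕ) * P.T + P.T := by exact_mod_cast h3
      rw [sub_le_iff_le_add, div_le_iff₀ hT]
      linarith
    have hle : (n : ℝ) * ρ ≤ ((n / P.T - 1) * P.bits : ℕ) := by
      push_cast [Nat.cast_sub hK]
      have h5 : ((n : ℝ) / P.T - 2) * P.bits ≤ (((n / P.T : ℕ) : ℝ) - 1) * P.bits :=
        mul_le_mul_of_nonneg_right (by linarith) (Nat.cast_nonneg _)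
      have h6 : (n : ℝ) / P.T * P.bits = n * (P.bits / P.T) := by ring
      linarith
    have hcard : ⌊(2 : ℝ) ^ ((n : ℝ) * ρ)⌋₊ ≤ Nat.card (P.Msg (n / P.T)) := by
      rw [WI1.card_msg]
      refine Nat.floor_le_of_le ?_
      push_cast
      rw [← Real.rpow_natCast]
      exact Real.rpow_le_rpow_of_exponent_le (by norm_num) hle
    rw [Nat.card_eq_fintype_card, ← Fintype.card_fin ⌊_⌋₊] at hcard
    obtain ⟨e⟩ := Function.Embedding.nonempty_of_card_le hcard
    have := hne n
    exact Code.exists_of_injective (P.code H (n / P.T)) (WI1.code_decoded hA hD)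
      (Nat.div_mul_le_self _ _) (fun _ => e) (fun _ => e.injective)
  -- A code is needed for every length; lengths without an error-free code get an arbitrary one,
  -- which does not affect the limit.
  have hex : ∀ n : ℕ, ∃ C : H.Code n (fun _ => Fin ⌊(2 : ℝ) ^ ((n : ℝ) * ρ)⌋₊),
      (∃ C' : H.Code n (fun _ => Fin ⌊(2 : ℝ) ^ ((n : ℝ) * ρ)⌋₊), ∀ w i, C'.decoded w i = w i) →
        ∀ w i, C.decoded w i = w i := by
    intro n
    by_cases h : ∃ C' : H.Code n (fun _ => Fin ⌊(2 : ℝ) ^ ((n : ℝ) * ρ)⌋₊),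
        ∀ w i, C'.decoded w i = w i
    · exact ⟨h.choose, fun _ => h.choose_spec⟩
    · exact ⟨⟨fun _ _ _ => 0, fun _ _ => 0, fun i _ => (hne n i).some⟩, fun h' => absurd h' h⟩
  choose C hC using hex
  refine ⟨C, tendsto_const_nhds.congr' ?_⟩
  filter_upwards [hev] with n hn
  exact ((C n).errorProb_eq_zero (hC n hn)).symm

end LDIRC

/-! ### Parameters for the four cases -/

namespace WI1

/-- The WI-1 scheme on pairs of channel uses with the given lengths. -/
def pairScheme (l1 l2 ccn cdf1 cdf2 ccf cp : ℕ) : WI1 where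
  -- With two channel uses per block the sum-rate `2 * bits / T` is `bits`, so odd integers are
  -- reached as well.
  T := 2
  l1 := l1
  l2 := l2
  R
    | .cn => ccn
    | .df1 => cdf1
    | .df2 => cdf2
    | .cf => ccf
    | .p => cp

/-- The transmit column fits by `relay_lower`, or by `rx_length` if `cn` and `df2` are absent; the
relay column is even kept within its top `2 * nr` entries. -/
theorem exists_decodable_of_pairScheme {nd nc nr ns r : ℕ} (l1 l2 ccn cdf1 cdf2 ccf cp : ℕ)
    (weak : nc < nd) (df1_le : 2 * cdf1 ≤ ccn)
    (aligned : 0 < ccn → ccf + 2 * cdf1 + 2 * cdf2 + l2 + 2 * nc = 2 * nr + l1)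
    (relay_upper : l1 + ccn + ccf ≤ 2 * ns)
    (relay_lower : (ccn = 0 ∧ cdf2 = 0) ∨ l1 + 2 * ccn + ccf + cp + 2 * cdf2 ≤ 2 * ns)
    (rx_length : l1 + ccn + ccf + cp ≤ 2 * nd)
    (rx_relay : 0 < ccf + 2 * cdf1 + 2 * cdf2 →
      ccf + 2 * cdf1 + 2 * cdf2 + 2 * nd ≤ 2 * nr + l1)
    (private_length : cp + 2 * nc ≤ 2 * nd)
    (relay_length : ccf + 2 * cdf1 + 2 * cdf2 + l2 + ccn ≤ 2 * nr)
    (hr : ccn + cdf1 + cdf2 + ccf + cp = r) :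
    ∃ P : WI1, P.Admissible ⟨nd, nc, nr, ns⟩ ∧ P.Decodable ⟨nd, nc, nr, ns⟩ ∧
      P.T = 2 ∧ P.bits = r := by
  have q1 := LDIRC.nd_le_q ⟨nd, nc, nr, ns⟩
  have q2 := LDIRC.nr_le_q ⟨nd, nc, nr, ns⟩
  have q3 := LDIRC.ns_le_q ⟨nd, nc, nr, ns⟩
  simp only at q1 q2 q3
  refine ⟨pairScheme l1 l2 ccn cdf1 cdf2 ccf cp, ⟨?_, ?_, ?_, ?_, ?_⟩, ⟨?_, ?_, ?_, ?_, ?_, ?_⟩,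
    rfl, hr⟩ <;> simp only [pairScheme, relayCnOffset] <;> first | assumption | omega

/-- In all of the four cases there is a WI-1 scheme of the claimed rate. -/
theorem exists_decodable (nd nc nr ns r : ℕ) (hweak : nc < nd)
    (hr :
      (nd ≤ ns ∧ ns ≤ nr ∧ r = min (ns + nd) (nr + ns - nc)) ∨
      (nc ≤ ns ∧ ns ≤ nd ∧ nd ≤ nr ∧ r = min (2 * nd) (nr + nd - nc)) ∨
      (nd ≤ nr ∧ nr ≤ ns ∧ r = min (nr + nd) (nr + ns - nc)) ∨
      (nc ≤ nr ∧ nr ≤ nd ∧ nd ≤ ns ∧ r = min (2 * nd) (ns + nd - nc))) :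
    ∃ P : WI1, P.Admissible ⟨nd, nc, nr, ns⟩ ∧ P.Decodable ⟨nd, nc, nr, ns⟩ ∧
      P.T = 2 ∧ P.bits = r := by
  rcases hr with ⟨h1, h2, hr⟩ | ⟨h1, h2, h3, hr⟩ | ⟨h1, h2, hr⟩ | ⟨h1, h2, h3, hr⟩
  -- In all four cases the private part takes the `2 * (nd - nc)` levels hidden from the other
  -- receiver, and wherever `cn` is used `l2` solves the alignment equation. Here `df1` and `df2`
  -- fill the relay's surplus `ns - nd`; if that surplus is below `nc`, `cf` takes over part of
  -- `cn`. The rate is `ns + nd` in the first two subcases and `nr + ns - nc` in the last.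
  · by_cases ha : nd + nc ≤ ns
    · refine exists_decodable_of_pairScheme 0 (2 * nr - 2 * nc - 2 * (ns - nd)) (2 * nc)
        (min (ns - nd) nc) (ns - nd - nc) 0 (2 * (nd - nc)) ?_ ?_ ?_ ?_ ?_ ?_ ?_ ?_ ?_ ?_ <;> omega
    · by_cases hb : nd + nc ≤ nr
      · refine exists_decodable_of_pairScheme 0 (2 * nr - 4 * nc) (2 * (ns - nd))
          (ns - nd) 0 (2 * (nd + nc - ns)) (2 * (nd - nc)) ?_ ?_ ?_ ?_ ?_ ?_ ?_ ?_ ?_ ?_ <;> omega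
      · refine exists_decodable_of_pairScheme 0 (2 * (nd - nc)) (2 * ns + nc - nd - nr)
          (ns - nd) 0 (2 * (nr - ns)) (2 * (nd - nc)) ?_ ?_ ?_ ?_ ?_ ?_ ?_ ?_ ?_ ?_ <;> omega
  -- Compute-forward only: `l1` complements `cf` to `2 * nc`, so the columns exactly fill the direct
  -- link, and `rx_relay` then reads `cf ≤ nr - nd + nc`.
  · refine exists_decodable_of_pairScheme (2 * nc - min (2 * nc) (nr - nd + nc)) 0 0
      0 0 (min (2 * nc) (nr - nd + nc)) (2 * (nd - nc)) ?_ ?_ ?_ ?_ ?_ ?_ ?_ ?_ ?_ ?_ <;> omega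
  -- No `cf`: the length of `cn` is limited by what the relay can see, and the surplus `nr - nd`
  -- goes to decode-forward, first on top of `cn` and then below it.
  · refine exists_decodable_of_pairScheme 0 (2 * (nd - nc)) (min (2 * nc) (ns - nd + nc))
      (min (nr - nd) nc) (nr - nd - nc) 0 (2 * (nd - nc)) ?_ ?_ ?_ ?_ ?_ ?_ ?_ ?_ ?_ ?_ <;> omega
  · refine exists_decodable_of_pairScheme 0 (2 * (nr - nc)) (min (2 * nc) (ns - nd + nc))
      0 0 0 (2 * (nd - nc)) ?_ ?_ ?_ ?_ ?_ ?_ ?_ ?_ ?_ ?_ <;> omega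

end WI1
end

/-! ### Comparison with the listed bounds and the closed formula -/

namespace LDIRC

/-- The minimum of the three upper bounds that are tight in the weak interference regime. -/
def tightBound (nd nc nr ns : ℕ) : ℕ :=
  min (max nd nr + nd) (min (nd + max nd ns) (max nd nr + (max nd ns - nc)))

/-- Both kinds of upper bounds that follow from the three tight counting bounds. -/
theorem le_tightBound {nd nc nr ns : ℕ} {s : ℝ}
    (h : ∀ B : ℕ, (∀ (n : ℕ) (W : Fin 2 → Type) (C : Code ⟨nd, nc, nr, ns⟩ n W),
      Nat.card C.good ≤ 2 ^ (n * B)) → s ≤ B) (hw : nc < nd) :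
    s ≤ tightBound nd nc nr ns := by
  rw [tightBound, Nat.cast_min, Nat.cast_min]
  exact le_min (h _ fun n W C => C.card_good_le_receivers hw.le)
    (le_min (h _ fun n W C => C.card_good_le_relay_genie hw.le)
      (h _ fun n W C => C.card_good_le_successive hw.le))

theorem tightBound_of_le_of_le {nd nc nr ns : ℕ} (hweak : nc < nd) (h1 : nd ≤ ns) (h2 : ns ≤ nr) :
    tightBound nd nc nr ns = min (ns + nd) (nr + ns - nc) := by
  rw [tightBound, max_eq_right (h1.trans h2), max_eq_right h1]
  omega

theorem tightBound_of_ns_le {nd nc nr ns : ℕ} (hweak : nc < nd) (h1 : ns ≤ nd) (h2 : nd ≤ nr) :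
    tightBound nd nc nr ns = min (2 * nd) (nr + nd - nc) := by
  rw [tightBound, max_eq_right h2, max_eq_left h1]
  omega

theorem tightBound_of_nr_le_ns {nd nc nr ns : ℕ} (hweak : nc < nd) (h1 : nd ≤ nr) (h2 : nr ≤ ns) :
    tightBound nd nc nr ns = min (nr + nd) (nr + ns - nc) := by
  rw [tightBound, max_eq_right h1, max_eq_right (h1.trans h2)]
  omega

theorem tightBound_of_nr_le {nd nc nr ns : ℕ} (hweak : nc < nd) (h1 : nr ≤ nd) (h2 : nd ≤ ns) :
    tightBound nd nc nr ns = min (2 * nd) (ns + nd - nc) := by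
  rw [tightBound, max_eq_left h1, max_eq_right h2]
  omega

/-- For `nc < nd`, three of the listed bounds are exactly the counting bounds; the others are either
vacuous or dominated in the four cases. -/
theorem tightBound_isLeast {nd nc nr ns : ℕ} (hweak : nc < nd)
    (hr : (nd ≤ ns ∧ ns ≤ nr) ∨ (nc ≤ ns ∧ ns ≤ nd ∧ nd ≤ nr) ∨ (nd ≤ nr ∧ nr ≤ ns) ∨
      (nc ≤ nr ∧ nr ≤ nd ∧ nd ≤ ns)) :
    IsLeast (upperBounds ⟨nd, nc, nr, ns⟩) (tightBound nd nc nr ns) := by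
  constructor
  · refine ⟨nd, nc, nr, ns, rfl, rfl, rfl, rfl, ?_⟩
    have h : tightBound nd nc nr ns = max nd nr + nd ∨ tightBound nd nc nr ns = nd + max nd ns ∨
        tightBound nd nc nr ns = max nd nr + (max nd ns - nc) := by
      unfold tightBound
      omega
    generalize tightBound nd nc nr ns = r at h
    rcases h with h | h | h
    · refine .inr (.inl ?_)
      exact_mod_cast (by omega : r = max (max nd nc) nr + max nd nc)
    · refine .inr (.inr (.inr (.inl ?_)))
      exact_mod_cast (by omega : r = max nd nc + max nd ns)
    · refine .inr (.inr (.inr (.inr (.inr (.inr (.inr ?_))))))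
      exact_mod_cast (by omega : (r : ℤ) = max (max (nd : ℤ) nr) nc + max (nd : ℤ) nc - nc
        + max ((ns : ℤ) - max (nd : ℤ) nc) 0)
  · rintro b ⟨_, _, _, _, rfl, rfl, rfl, rfl, h⟩
    have h1 : tightBound nd nc nr ns ≤ max nd nr + nd := min_le_left _ _
    have h2 : tightBound nd nc nr ns ≤ nd + max nd ns := (min_le_right _ _).trans (min_le_left _ _)
    have h3 : tightBound nd nc nr ns ≤ max nd nr + (max nd ns - nc) :=
      (min_le_right _ _).trans (min_le_right _ _)
    generalize tightBound nd nc nr ns = r at h1 h2 h3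
    rcases h with ⟨h, _⟩ | rfl | rfl | rfl | rfl | ⟨h, _, rfl⟩ | rfl | rfl
    · have h' : nd = nc := by exact_mod_cast h
      omega
    · exact_mod_cast (by omega : r ≤ max (max nd nc) nr + max nd nc)
    · exact_mod_cast (by omega : (r : ℤ) ≤ nr + 2 * max (nd : ℤ) nc - nc)
    · exact_mod_cast (by omega : r ≤ max nd nc + max nd ns)
    · exact_mod_cast (by omega : (r : ℤ) ≤ 2 * max (max (nc : ℤ) nr) (nd - max (nc : ℤ) ns)
        + 2 * max ((ns : ℤ) - nc) 0)
    · have h' : nr ≤ nc := by exact_mod_cast h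
      exact_mod_cast (by omega : (r : ℤ) ≤ 2 * max (nc : ℤ) (nr + nd - nc))
    · exact_mod_cast (by omega : r ≤ 2 * max nd nr)
    · exact_mod_cast (by omega : (r : ℤ) ≤ max (max (nd : ℤ) nr) nc + max (nd : ℤ) nc - nc
        + max ((ns : ℤ) - max (nd : ℤ) nc) 0)

/-- Since `-x⁺ = min 0 (-x)`, the second term of the formula merges the two-receiver and the
successive bound; the fifth is the relay-genie bound. The other terms are never smaller. -/
theorem tightBound_eq_capacityFormula {nd nc nr ns : ℕ} (hweak : nc < nd)
    (hr : (nd ≤ ns ∧ ns ≤ nr) ∨ (nc ≤ ns ∧ ns ≤ nd ∧ nd ≤ nr) ∨ (nd ≤ nr ∧ nr ≤ ns) ∨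
      (nc ≤ nr ∧ nr ≤ nd ∧ nd ≤ ns)) (hs : nc < ns) :
    (tightBound nd nc nr ns : ℝ) = capacityFormula nd nc nr ns := by
  have h : (tightBound nd nc nr ns : ℤ) =
      min (2 * max (nd : ℤ) nr)
        (min (max (max (nd : ℤ) nc) nr + max (nd : ℤ) nc
            - max ((nc : ℤ) - max ((ns : ℤ) - max (nd : ℤ) nc) 0) 0)
          (min ((nr : ℤ) + 2 * max (nd : ℤ) nc - nc)
            (min (2 * max (max (ns : ℤ) (nr + ns - nc)) (nd - nc))
              (min (max (nd : ℤ) nc + max (nd : ℤ) ns)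
                (2 * max (nc : ℤ) (nr + max ((nd : ℤ) - nc) 0)))))) := by
    unfold tightBound
    -- All four cases give `nc ≤ nr` and `nd ≤ nr + ns`, which fixes the value of these maxima.
    rw [max_eq_left (by omega : (nc : ℤ) ≤ nd), max_eq_left (by omega : (0 : ℤ) ≤ nd - nc),
      max_eq_right (by omega : (ns : ℤ) ≤ nr + ns - nc),
      max_eq_left (by omega : (nd : ℤ) - nc ≤ nr + ns - nc),
      max_eq_right (by omega : (nc : ℤ) ≤ nr + (nd - nc))]
    rcases le_total nd nr with h1 | h1 <;> rcases le_total nd ns with h2 | h2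
    · rw [max_eq_right h1, max_eq_right h2, max_eq_right (by omega : (nd : ℤ) ≤ nr),
        max_eq_right (by omega : (nd : ℤ) ≤ ns), max_eq_left (by omega : (0 : ℤ) ≤ ns - nd)]
      omega
    · rw [max_eq_right h1, max_eq_left h2, max_eq_right (by omega : (nd : ℤ) ≤ nr),
        max_eq_left (by omega : (ns : ℤ) ≤ nd), max_eq_right (by omega : (ns : ℤ) - nd ≤ 0)]
      omega
    · rw [max_eq_left h1, max_eq_right h2, max_eq_left (by omega : (nr : ℤ) ≤ nd),
        max_eq_right (by omega : (nd : ℤ) ≤ ns), max_eq_left (by omega : (0 : ℤ) ≤ ns - nd)]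
      omega
    · rw [max_eq_left h1, max_eq_left h2, max_eq_left (by omega : (nr : ℤ) ≤ nd),
        max_eq_left (by omega : (ns : ℤ) ≤ nd), max_eq_right (by omega : (ns : ℤ) - nd ≤ 0)]
      omega
  unfold capacityFormula
  exact_mod_cast h

end LDIRC

theorem mainTheorem6 (nd nc nr ns : ℕ) (r : ℝ) (hweak : nc < nd)
    (hr :
      (nd ≤ ns ∧ ns ≤ nr ∧ r = min ((ns : ℝ) + nd) ((nr : ℝ) + ns - nc)) ∨
      (nc ≤ ns ∧ ns ≤ nd ∧ nd ≤ nr ∧ r = min (2 * (nd : ℝ)) ((nr : ℝ) + nd - nc)) ∨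
      (nd ≤ nr ∧ nr ≤ ns ∧ r = min ((nr : ℝ) + nd) ((nr : ℝ) + ns - nc)) ∨
      (nc ≤ nr ∧ nr ≤ nd ∧ nd ≤ ns ∧ r = min (2 * (nd : ℝ)) ((ns : ℝ) + nd - nc))) :
    IsGreatest {s : ℝ | WI1.Achieves ⟨nd, nc, nr, ns⟩ s} r ∧
    IsLUB (LDIRC.achievableSumRates ⟨nd, nc, nr, ns⟩) r ∧
    IsLeast (LDIRC.upperBounds ⟨nd, nc, nr, ns⟩) r ∧
    (nc < ns → r = LDIRC.capacityFormula nd nc nr ns)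
  := by
  have hcase : (nd ≤ ns ∧ ns ≤ nr) ∨ (nc ≤ ns ∧ ns ≤ nd ∧ nd ≤ nr) ∨ (nd ≤ nr ∧ nr ≤ ns) ∨
      (nc ≤ nr ∧ nr ≤ nd ∧ nd ≤ ns) := by tauto
  have hsub : ∀ a b : ℕ, nc ≤ a + b → ((a + b - nc : ℕ) : ℝ) = (a : ℝ) + b - nc := fun a b h => by
    rw [Nat.cast_sub h, Nat.cast_add]
  have hrt : r = (LDIRC.tightBound nd nc nr ns : ℕ) := by
    rcases hr with ⟨h1, h2, rfl⟩ | ⟨h1, h2, h3, rfl⟩ | ⟨h1, h2, rfl⟩ | ⟨h1, h2, h3, rfl⟩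
    · rw [LDIRC.tightBound_of_le_of_le hweak h1 h2, Nat.cast_min, hsub _ _ (by omega)]
      push_cast
      rfl
    · rw [LDIRC.tightBound_of_ns_le hweak h2 h3, Nat.cast_min, hsub _ _ (by omega)]
      push_cast
      rfl
    · rw [LDIRC.tightBound_of_nr_le_ns hweak h1 h2, Nat.cast_min, hsub _ _ (by omega)]
      push_cast
      rfl
    · rw [LDIRC.tightBound_of_nr_le hweak h2 h3, Nat.cast_min, hsub _ _ (by omega)]
      push_cast
      rfl
  have hr' : (nd ≤ ns ∧ ns ≤ nr ∧ LDIRC.tightBound nd nc nr ns = min (ns + nd) (nr + ns - nc)) ∨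
      (nc ≤ ns ∧ ns ≤ nd ∧ nd ≤ nr ∧
        LDIRC.tightBound nd nc nr ns = min (2 * nd) (nr + nd - nc)) ∨
      (nd ≤ nr ∧ nr ≤ ns ∧ LDIRC.tightBound nd nc nr ns = min (nr + nd) (nr + ns - nc)) ∨
      (nc ≤ nr ∧ nr ≤ nd ∧ nd ≤ ns ∧
        LDIRC.tightBound nd nc nr ns = min (2 * nd) (ns + nd - nc)) := by
    rcases hcase with ⟨h1, h2⟩ | ⟨h1, h2, h3⟩ | ⟨h1, h2⟩ | ⟨h1, h2, h3⟩
    · exact .inl ⟨h1, h2, LDIRC.tightBound_of_le_of_le hweak h1 h2⟩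
    · exact .inr (.inl ⟨h1, h2, h3, LDIRC.tightBound_of_ns_le hweak h2 h3⟩)
    · exact .inr (.inr (.inl ⟨h1, h2, LDIRC.tightBound_of_nr_le_ns hweak h1 h2⟩))
    · exact .inr (.inr (.inr ⟨h1, h2, h3, LDIRC.tightBound_of_nr_le hweak h2 h3⟩))
  obtain ⟨P, hA, hD, hT, hbits⟩ := WI1.exists_decodable nd nc nr ns
    (LDIRC.tightBound nd nc nr ns) hweak hr'
  have hpos : 0 < LDIRC.tightBound nd nc nr ns := by
    unfold LDIRC.tightBound
    omega
  subst hrt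
  refine ⟨⟨?_, fun s hs => LDIRC.le_tightBound (fun B hB => WI1.le_of_achieves hB hs) hweak⟩,
    ⟨fun s hs => LDIRC.le_tightBound
      (fun B hB => LDIRC.mem_upperBounds_of_card_good_le hB hs) hweak, fun b hb => ?_⟩,
    LDIRC.tightBound_isLeast hweak hcase,
    LDIRC.tightBound_eq_capacityFormula hweak hcase⟩
  · have h := WI1.achieves_of_decodable hA hD
    rw [hT, hbits, Nat.cast_ofNat, mul_div_cancel_left₀ _ two_ne_zero] at h
    exact h
  · have hpos' : (0 : ℝ) < LDIRC.tightBound nd nc nr ns := by exact_mod_cast hpos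
    refine le_of_forall_lt_imp_le_of_dense fun s hs => ?_
    -- Splitting `max s 0` equally keeps the rates nonnegative for negative `s`; positivity of the
    -- claimed capacity keeps them strictly below the scheme's rate.
    have hρ : max s 0 / 2 < P.bits / P.T := by
      rw [hT, hbits, Nat.cast_ofNat]
      have := max_lt hs hpos'
      linarith
    have := hb ⟨_, LDIRC.achievable_of_decodable hA hD (by positivity) hρ, rfl⟩
    linarith [le_max_left s 0]
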